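/- Let $X$ be a closed connected surface whose topology is given by a geodesic distance $d$ (the distance of two points is the infimum of the lengths of the paths joining them), and let $T$ be a finite polygonal tiling of $X$: its vertices are points and its edges are arcs of $X$, its faces are polygons with at least three sides (images of closed discs, embedded on the open discs, whose boundary circles run along edges), the open faces are pairwise disjoint and disjoint from the vertices and edges, and the faces cover $X$. Let $G=(V,E)$ be the 1-skeleton of $T$, and suppose that $G$ is a regular graph, or a semi-regular bipartite graph (bipartite, with all vertices of the same class having the same degree), and that the girth of $G$ is greater than $5$ (no cycles of length at most $5$). Give every edge $e=\{x,y\}$ the initial weight $\omega_0(e)=d(x,y)$, the geodesic distance of its end points. For positive edge weights $\omega$ put $m(x)=\sum_{y\sim x}\omega_{xy}$, and let the Lin-Lu-Yau curvature of an edge $e=\{x,y\}$ be $$\kappa_e(\omega)=\lim_{\alpha\to1^-}\frac{1}{1-\alpha}\bigl(1-W(m_x^\alpha,m_y^\alpha)\bigr),$$ where $m_x^\alpha$ is the probability distribution on $V$ with mass $\alpha$ at $x$ and mass $(1-\alpha)\omega_{xy}/m(x)$ at each neighbour $y$ of $x$, and $W$ is the Wasserstein distance for the combinatorial (hop-count)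 distance of $G$. Let $\bar\kappa=\frac1{|E|}\sum_{e\in E}\kappa_e$ be the average curvature. Then the normalized constant-curvature flow $$\frac{d}{dt}\omega(t,e)=-\bigl(\kappa_e(\omega(t))-\bar\kappa\bigr)\,\omega(t,e)\quad(t>0,\ e\in E),\qquad \omega(0)=\omega_0,$$ has a unique positive solution on $[0,\infty)$; along it $\bar\kappa=2(|V|/|E|-1)$; and the solution converges, exponentially fast, to constant edge weights: there are $c>0$, $C$ and $\lambda>0$ with $|\omega(t,e)-c|\le Ce^{-\lambda t}$ for all $t\ge0$ and $e\in E$. The limit corresponds to a polygonal partition of the surface with constant edge lengths: there is a geodesic distance on $X$ that induces the same topology and for which every edge of $T$ is a geodesic segment of length $c$. -/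

import Mathlib

open Set Filter Topology

noncomputable section

/-! ### Weighted graphs and Lin-Lu-Yau curvature -/

section Graph

variable {V : Type*} (G : SimpleGraph V)

open Classical in
/-- The weight `ω_{xy}` of the pair `x, y`: the weight of the edge if `x ∼ y`, and `0` otherwise. -/
def edgeWeight (w : G.edgeSet → ℝ) (x y : V) : ℝ :=
  if h : G.Adj x y then w ⟨s(x, y), h⟩ else 0

/-- `m(x) = ∑_{y ∼ x} ω_{xy}`. -/
def vertexWeight [Fintype V] (w : G.edgeSet → ℝ) (x : V) : ℝ :=
  ∑ y, edgeWeight G w x y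

open Classical in
/-- The lazy one-step distribution `m_x^α`: mass `α` at `x` and mass `(1 - α) ω_{xy} / m(x)` at
each neighbour `y` of `x` (for the other vertices `edgeWeight` vanishes). -/
def lazyStep [Fintype V] (w : G.edgeSet → ℝ) (α : ℝ) (x y : V) : ℝ :=
  if y = x then α else (1 - α) * (edgeWeight G w x y / vertexWeight G w x)

/-- `A` is a transport plan from `μ` to `ν`. -/
structure IsTransportPlan [Fintype V] (μ ν : V → ℝ) (A : V → V → ℝ) : Prop where
  mem_Icc : ∀ u v, A u v ∈ Icc (0 : ℝ) 1
  left : ∀ u, ∑ v, A u v = μ u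
  right : ∀ v, ∑ u, A u v = ν v

/-- The Wasserstein distance for the combinatorial graph distance. -/
def wasserstein [Fintype V] (μ ν : V → ℝ) : ℝ :=
  sInf {c : ℝ | ∃ A, IsTransportPlan μ ν A ∧ c = ∑ u, ∑ v, (G.dist u v : ℝ) * A u v}

/-- `k` is the Lin-Lu-Yau curvature `κ(x, y)` of the weighted graph `(G, w)`:
`κ(x, y) = lim_{α → 1⁻} (1 - W(m_x^α, m_y^α) / d(x, y)) / (1 - α)`, the limit being part of the
assertion. -/
def HasLLYCurvature [Fintype V] (w : G.edgeSet → ℝ) (x y : V) (k : ℝ) : Prop :=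
  Tendsto
    (fun α : ℝ => 1 / (1 - α) *
      (1 - wasserstein G (lazyStep G w α x) (lazyStep G w α y) / (G.dist x y : ℝ)))
    (𝓝[<] 1) (𝓝 k)

open Classical in
/-- The average of a function on the edges. -/
def edgeAverage [Fintype V] (k : G.edgeSet → ℝ) : ℝ :=
  (∑ e, k e) / (Fintype.card G.edgeSet : ℝ)

/-- `w` is a positive solution on `[0, ∞)` of the normalized (constant-curvature) flow
`dω_e/dt = -(κ_e - κ̄) ω_e`, `ω(0) = w₀`, where `κ t e` is the Lin-Lu-Yau curvature of the edge `e`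
for the weights `w t` and `κ̄` is the average of `κ t` over the edges. -/
structure IsNormalizedFlow [Fintype V] (w₀ : G.edgeSet → ℝ) (w κ : ℝ → G.edgeSet → ℝ) :
    Prop where
  initial : w 0 = w₀
  pos : ∀ t, 0 ≤ t → ∀ e, 0 < w t e
  continuousOn : ∀ e, ContinuousOn (fun t => w t e) (Ici 0)
  curvature : ∀ t, 0 < t → ∀ x y (h : G.Adj x y),
    HasLLYCurvature G (w t) x y (κ t ⟨s(x, y), h⟩)
  flow : ∀ t, 0 < t → ∀ e,
    HasDerivAt (fun s => w s e) (-(κ t e - edgeAverage G (κ t)) * w t e) t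

/-- `G` is regular. -/
def IsRegularGraph [Fintype V] : Prop :=
  ∃ k : ℕ, ∀ x, (G.neighborSet x).ncard = k

/-- `G` is semi-regular bipartite: it is bipartite, and all the vertices in the same class of
some bipartition have the same degree. -/
def IsSemiregularBipartite [Fintype V] : Prop :=
  ∃ (A B : Set V) (a b : ℕ), A ∪ B = univ ∧ G.IsBipartiteWith A B ∧
    (∀ x ∈ A, (G.neighborSet x).ncard = a) ∧ ∀ x ∈ B, (G.neighborSet x).ncard = b

end Graph

/-! ### Polygonal tilings of surfaces -/

/-- The metric `m` induces the given topology of `X` and is a geodesic distance (a length metric):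
the distance of two points is the infimum of the lengths of the paths that join them. -/
def IsGeodesicMetric {X : Type*} (m : MetricSpace X) [t : TopologicalSpace X] : Prop :=
  m.toPseudoMetricSpace.toUniformSpace.toTopologicalSpace = t ∧
    ∀ x y : X, edist x y = ⨅ γ : Path x y, eVariationOn γ univ

/-- The point with parameter `t ∈ [0, 1]` on the `j`-th of the `n` equal arcs (the sides of the
model `n`-gon) into which the unit circle is divided by its corners `exp (2 π i j / n)`. -/
def sidePoint (n j : ℕ) (t : ℝ) : ℂ :=
  Complex.exp (((2 * Real.pi * ((j + t) / n) : ℝ) : ℂ) * Complex.I)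

/-- A polygonal tiling, with vertices `V` and faces `F`, of the space `X`. The edges are arcs in
`X` that meet one another and the vertices only at end points; its vertices and edges form a
simple graph, the 1-skeleton. Each face is a polygon with `n ≥ 3` sides: the image of the closed
unit disc, whose boundary circle is divided into `n` arcs, under a continuous map that
is injective on the open disc and carries the successive boundary arcs to successive
edges (so that sides, also of one face, may be identified with each other in `X`). Interiors of
different faces are disjoint, and disjoint from the 1-skeleton, and the faces cover `X`. -/
structure PolygonalTiling (V F X : Type*) [TopologicalSpace X] where
  graph : SimpleGraph V
  vertex : V → X
  vertex_injective : Function.Injective vertex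
  edge : ∀ {x y : V}, graph.Adj x y → Path (vertex x) (vertex y)
  edge_symm : ∀ {x y : V} (h : graph.Adj x y), edge h.symm = (edge h).symm
  edge_injective : ∀ {x y : V} (h : graph.Adj x y), Function.Injective (edge h)
  edge_ne_vertex : ∀ {x y : V} (h : graph.Adj x y) (s : unitInterval) (z : V),
    s ≠ 0 → s ≠ 1 → edge h s ≠ vertex z
  edge_disjoint : ∀ {x y x' y' : V} (h : graph.Adj x y) (h' : graph.Adj x' y')
    (s s' : unitInterval), s ≠ 0 → s ≠ 1 → edge h s = edge h' s' → s(x, y) = s(x', y')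
  sides : F → ℕ
  three_le_sides : ∀ f, 3 ≤ sides f
  /-- The `j`-th corner of the face, for `j` modulo the number of sides. -/
  corner : F → ℕ → V
  corner_adj : ∀ f j, graph.Adj (corner f j) (corner f (j + 1))
  chart : F → ℂ → X
  chart_continuousOn : ∀ f, ContinuousOn (chart f) (Metric.closedBall 0 1)
  chart_side : ∀ f j (s : unitInterval),
    chart f (sidePoint (sides f) j s) = edge (corner_adj f j) s
  chart_interior : ∀ f g, ∀ z ∈ Metric.ball (0 : ℂ) 1, ∀ z' ∈ Metric.ball (0 : ℂ) 1,
    chart f z = chart g z' → f = g ∧ z = z'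
  chart_ne_vertex : ∀ f, ∀ z ∈ Metric.ball (0 : ℂ) 1, ∀ v : V, chart f z ≠ vertex v
  chart_ne_edge : ∀ f, ∀ z ∈ Metric.ball (0 : ℂ) 1, ∀ {x y : V} (h : graph.Adj x y)
    (s : unitInterval), chart f z ≠ edge h s
  cover : ∀ p : X, ∃ f, ∃ z ∈ Metric.closedBall (0 : ℂ) 1, chart f z = p

/-- The edge weights given by a metric on `X`: the weight of an edge is the distance of its
two end points. -/
def PolygonalTiling.edgeDist {V F X : Type*} [TopologicalSpace X] (T : PolygonalTiling V F X)
    (m : MetricSpace X) (e : T.graph.edgeSet) : ℝ :=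
  Sym2.lift ⟨fun x y => m.dist (T.vertex x) (T.vertex y), fun _ _ => m.dist_comm _ _⟩ e.1

/-- With respect to the metric `m` on `X`, every edge of the tiling is a geodesic segment (an
isometrically embedded interval) of length `c`. -/
def PolygonalTiling.HasConstantEdgeLength {V F X : Type*} [TopologicalSpace X]
    (T : PolygonalTiling V F X) (m : MetricSpace X) (c : ℝ) : Prop :=
  ∀ {x y : V} (h : T.graph.Adj x y) (s s' : unitInterval),
    m.dist (T.edge h s) (T.edge h s') = c * |(s : ℝ) - (s' : ℝ)|

end

/-! Curvature. With no cycles of length at most five, the transport between two adjacent lazy steps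
is explicit. The plan `edgePlan` and the potential `edgePotential`, compared by weak Kantorovich
duality, give the same value of the Wasserstein distance for all α ∈ [1/2, 1]. Hence κ_xy =
2(ω_xy/m(x) + ω_xy/m(y)) - 2. At each vertex the ratios ω_e/m(x) sum to 1, so the average curvature
is always 2(|V|/|E| - 1).

Flow. In a regular or semi-regular bipartite graph 1/deg x + 1/deg y is the same for all edges xy,
and double counting shows that it is |V|/|E|. Therefore u = log ω satisfies u' = `logFlowField` u:
at every vertex the uniform distribution on the incident edges minus the softmax of u, summed over
the two ends of the edge and doubled. This field is C¹ and bounded, so solutions are global and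
unique, and it conserves ∑ u. Let k be the mean of u. The derivative of ∑ (u_e - k)² is nonpositive,
because each vertex contributes a sum of products (u_e - u_f)(exp u_e - exp u_f) ≥ 0. Thus u stays
bounded, the monotonicity of exp becomes uniform, and a Poincaré inequality on the connected
1-skeleton gives exponential decay to k. Exponentiating gives the limit weight c = exp k.

Metric. Each face is cut into polar sectors, images of the unit square with its sup metric. The
largest distance for which all sector maps are c-Lipschitz is a geodesic metric inducing the given
topology, once functions that are Lipschitz along the sectors separate points (`exists_separating`).
An edge is a side of some sector, which bounds distances along it from above. A function extending
the parameter of the edge, 1-Lipschitz along every sector, bounds them from below. -/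

/-! ### Quotient length metrics -/

section QuotientMetric

/-- In a preconnected space covered by finitely many closed sets, a nonempty set that contains or
misses each of them is everything. -/
theorem eq_univ_of_finite_closed_cover {ι X : Type*} [Finite ι] [TopologicalSpace X]
    [PreconnectedSpace X] (K : ι → Set X) (hK : ∀ i, IsClosed (K i)) (hcov : ∀ p, ∃ i, p ∈ K i)
    (S : Set X) (hS : S.Nonempty) (hKS : ∀ i, K i ⊆ S ∨ K i ⊆ Sᶜ) : S = univ := by
  -- Both `S` and its complement are finite unions of closed pieces, so `S` is clopen.
  have key : ∀ T : Set X, (∀ i, K i ⊆ T ∨ K i ⊆ Tᶜ) → IsClosed T := by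
    intro T hT
    have : T = ⋃ i : {i // K i ⊆ T}, K i := by
      apply Subset.antisymm
      · intro p hp
        obtain ⟨i, hi⟩ := hcov p
        rcases hT i with h | h
        · exact mem_iUnion.2 ⟨⟨i, h⟩, hi⟩
        · exact absurd hp (h hi)
      · exact iUnion_subset fun i => i.2
    rw [this]
    exact isClosed_iUnion_of_finite fun i => hK i
  refine IsClopen.eq_univ ⟨key S hKS, ?_⟩ hS
  rw [← isClosed_compl_iff]
  exact key _ fun i => (hKS i).symm.imp id fun h => by rwa [compl_compl]

/-- Any two points of `Q` are joined by a geodesic segment of constant speed. -/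
def HasGeodesics (Q : Type*) [PseudoMetricSpace Q] : Prop :=
  ∀ a b : Q, ∃ γ : Path a b, ∀ s t, dist (γ s) (γ t) ≤ dist a b * dist s t

theorem hasGeodesics_unitInterval : HasGeodesics unitInterval := by
  intro a b
  have hmem : ∀ s : unitInterval, (1 - s : ℝ) * a + s * b ∈ unitInterval := by
    intro s
    have := a.2.1; have := a.2.2; have := b.2.1; have := b.2.2; have := s.2.1; have := s.2.2
    constructor
    · have : (0 : ℝ) ≤ 1 - s := by linarith
      positivity
    · nlinarith
  refine ⟨⟨⟨fun s => ⟨(1 - s : ℝ) * a + s * b, hmem s⟩, by fun_prop⟩, by simp, by simp⟩, ?_⟩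
  intro s t
  change dist ((1 - s : ℝ) * a + s * b) ((1 - t : ℝ) * a + t * b) ≤ _
  rw [Subtype.dist_eq, Subtype.dist_eq, Real.dist_eq, Real.dist_eq, Real.dist_eq, ← abs_mul]
  rw [show (1 - s : ℝ) * a + s * b - ((1 - t : ℝ) * a + t * b) = -(((a : ℝ) - b) * (s - t)) by ring,
    abs_neg]

/-- For the sup metric, moving at constant speed in both factors at once is geodesic. -/
theorem HasGeodesics.prod {Q R : Type*} [PseudoMetricSpace Q] [PseudoMetricSpace R]
    (hQ : HasGeodesics Q) (hR : HasGeodesics R) : HasGeodesics (Q × R) := by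
  rintro ⟨a, a'⟩ ⟨b, b'⟩
  obtain ⟨γ, hγ⟩ := hQ a b
  obtain ⟨γ', hγ'⟩ := hR a' b'
  refine ⟨γ.prod γ', fun s t => ?_⟩
  rw [Path.prod_coe, Prod.dist_eq, Prod.dist_eq]
  exact max_le ((hγ s t).trans (mul_le_mul_of_nonneg_right (le_max_left _ _) dist_nonneg))
    ((hγ' s t).trans (mul_le_mul_of_nonneg_right (le_max_right _ _) dist_nonneg))

variable {ι Q X : Type*} [PseudoMetricSpace Q]

/-- `ChainCost P c p q ℓ`: the points `p` and `q` are joined by a chain of total cost `ℓ`, each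
link of which joins two points `P i a` and `P i b` at the cost `c * dist a b`. -/
inductive ChainCost (P : ι → Q → X) (c : ℝ) : X → X → ℝ → Prop
  | refl (p : X) : ChainCost P c p p 0
  | step {p : X} {ℓ : ℝ} {i : ι} (a b : Q) (h : ChainCost P c p (P i a) ℓ) :
      ChainCost P c p (P i b) (ℓ + c * dist a b)

variable {P : ι → Q → X} {c : ℝ}

theorem ChainCost.single (i : ι) (a b : Q) : ChainCost P c (P i a) (P i b) (c * dist a b) := by
  simpa using ChainCost.step a b (ChainCost.refl (P := P) (c := c) (P i a))

theorem ChainCost.trans {p q r : X} {ℓ ℓ' : ℝ} (h : ChainCost P c p q ℓ)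
    (h' : ChainCost P c q r ℓ') : ChainCost P c p r (ℓ + ℓ') := by
  induction h' with
  | refl => simpa using h
  | step a b _ ih => rw [← add_assoc]; exact ih.step a b

theorem ChainCost.symm {p q : X} {ℓ : ℝ} (h : ChainCost P c p q ℓ) : ChainCost P c q p ℓ := by
  induction h with
  | refl => exact .refl _
  | step a b _ ih =>
    rw [add_comm, dist_comm]
    exact (ChainCost.single _ b a).trans ih

theorem ChainCost.nonneg (hc : 0 ≤ c) {p q : X} {ℓ : ℝ} (h : ChainCost P c p q ℓ) : 0 ≤ ℓ := by
  induction h with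
  | refl => exact le_rfl
  | step a b _ ih => positivity

/-- Telescoping along the chain; this is the source of all lower bounds for the chain distance. -/
theorem ChainCost.abs_sub_le {φ : X → ℝ} {K : ℝ}
    (hφ : ∀ i a b, |φ (P i a) - φ (P i b)| ≤ K * (c * dist a b)) {p q : X} {ℓ : ℝ}
    (h : ChainCost P c p q ℓ) : |φ p - φ q| ≤ K * ℓ := by
  induction h with
  | refl => simp
  | step a b _ ih =>
    rw [mul_add]
    exact (_root_.abs_sub_le _ _ _).trans (add_le_add ih (hφ _ a b))

/-- In a connected space covered by finitely many compact pieces any two points are joined by a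
chain. -/
theorem exists_chainCost [Finite ι] [TopologicalSpace X] [PreconnectedSpace X] [T2Space X]
    [CompactSpace Q] (hP : ∀ i, Continuous (P i)) (hcov : ∀ p, ∃ i a, P i a = p) (p q : X) :
    ∃ ℓ, ChainCost P c p q ℓ := by
  have : {q | ∃ ℓ, ChainCost P c p q ℓ} = univ := by
    refine eq_univ_of_finite_closed_cover (fun i => range (P i))
      (fun i => (isCompact_range (hP i)).isClosed) hcov _ ⟨p, 0, .refl p⟩ fun i => ?_
    by_cases h : ∃ a ℓ, ChainCost P c p (P i a) ℓ
    · obtain ⟨a, ℓ, h⟩ := h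
      left
      rintro _ ⟨b, rfl⟩
      exact ⟨_, h.step a b⟩
    · right
      rintro _ ⟨b, rfl⟩ ⟨ℓ, hb⟩
      exact h ⟨b, ℓ, hb⟩
  exact this.symm.subset (mem_univ q)

/-- The distance for which each map `P i` is `c`-Lipschitz and that is largest with that
property. -/
noncomputable def chainDist (P : ι → Q → X) (c : ℝ) (p q : X) : ℝ :=
  sInf {ℓ | ChainCost P c p q ℓ}

theorem bddBelow_chainCost (hc : 0 ≤ c) (p q : X) : BddBelow {ℓ | ChainCost P c p q ℓ} :=
  ⟨0, fun _ h => ChainCost.nonneg hc h⟩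

theorem chainDist_le (hc : 0 ≤ c) {p q : X} {ℓ : ℝ} (h : ChainCost P c p q ℓ) :
    chainDist P c p q ≤ ℓ :=
  csInf_le (bddBelow_chainCost hc p q) h

theorem chainDist_map_le (hc : 0 ≤ c) (i : ι) (a b : Q) :
    chainDist P c (P i a) (P i b) ≤ c * dist a b :=
  chainDist_le hc (.single i a b)

theorem chainDist_comm (p q : X) : chainDist P c p q = chainDist P c q p := by
  unfold chainDist
  congr 1
  ext ℓ
  exact ⟨.symm, .symm⟩

theorem abs_sub_le_chainDist {φ : X → ℝ} {K : ℝ} (hK : 0 ≤ K)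
    (hφ : ∀ i a b, |φ (P i a) - φ (P i b)| ≤ K * (c * dist a b)) {p q : X}
    (h : ∃ ℓ, ChainCost P c p q ℓ) : |φ p - φ q| ≤ K * chainDist P c p q := by
  rcases hK.eq_or_lt with rfl | hK
  · obtain ⟨ℓ, h⟩ := h
    simpa using h.abs_sub_le hφ
  · rw [← div_le_iff₀' hK]
    refine le_csInf h fun ℓ hℓ => ?_
    rw [div_le_iff₀' hK]
    exact ChainCost.abs_sub_le hφ hℓ

/-- Nearly optimal chains are concatenated. Chains must exist, since the infimum of the empty set of
reals is 0. -/
theorem chainDist_triangle (hc : 0 ≤ c) (hex : ∀ p q, ∃ ℓ, ChainCost P c p q ℓ) (p q r : X) :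
    chainDist P c p r ≤ chainDist P c p q + chainDist P c q r := by
  refine le_of_forall_pos_le_add fun ε hε => ?_
  obtain ⟨ℓ, hℓ, h⟩ := exists_lt_of_csInf_lt (hex p q)
    (show chainDist P c p q < chainDist P c p q + ε / 2 by linarith)
  obtain ⟨ℓ', hℓ', h'⟩ := exists_lt_of_csInf_lt (hex q r)
    (show chainDist P c q r < chainDist P c q r + ε / 2 by linarith)
  have := chainDist_le hc (ChainCost.trans hℓ hℓ')
  linarith

/-- Variation is additive at the midpoint and does not grow under monotone reparametrization. The
reparametrizations are clamped by `min` and `max` to be defined on the whole interval. -/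
theorem eVariationOn_path_trans_le {X : Type*} [PseudoMetricSpace X] {x y z : X} (γ : Path x y)
    (γ' : Path y z) :
    eVariationOn (γ.trans γ') univ ≤ eVariationOn γ univ + eVariationOn γ' univ := by
  have hh : (1 / 2 : ℝ) ∈ unitInterval := by constructor <;> norm_num
  set m : unitInterval := ⟨1 / 2, hh⟩
  have hu : (univ : Set unitInterval) = Iic m ∪ Ici m := by
    ext s; simp
  rw [hu, eVariationOn.union _ isGreatest_Iic isLeast_Ici]
  refine add_le_add ?_ ?_
  · have hp : ∀ s : unitInterval, min (2 * s : ℝ) 1 ∈ unitInterval := fun s =>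
      ⟨le_min (mul_nonneg two_pos.le s.2.1) zero_le_one, min_le_right _ _⟩
    have h1 : EqOn (γ.trans γ') (γ ∘ fun s => (⟨min (2 * s : ℝ) 1, hp s⟩ : unitInterval))
        (Iic m) := by
      intro s hs
      have hs' : (s : ℝ) ≤ 1 / 2 := hs
      rw [Path.trans_apply, dif_pos hs']
      simp only [Function.comp]
      congr 2
      exact (min_eq_left (by linarith)).symm
    rw [eVariationOn.congr h1]
    refine (eVariationOn.comp_le_of_monotoneOn _ _ ?_ (mapsTo_univ _ _)).trans (by rw [← hu])
    intro s _ t _ hst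
    have : (s : ℝ) ≤ t := hst
    exact Subtype.mk_le_mk.2 (min_le_min_right _ (by linarith))
  · have hp : ∀ s : unitInterval, max (2 * s - 1 : ℝ) 0 ∈ unitInterval := fun s =>
      ⟨le_max_right _ _, max_le (by linarith [s.2.2]) zero_le_one⟩
    have h1 : EqOn (γ.trans γ') (γ' ∘ fun s => (⟨max (2 * s - 1 : ℝ) 0, hp s⟩ : unitInterval))
        (Ici m) := by
      intro s hs
      have hs' : 1 / 2 ≤ (s : ℝ) := hs
      rw [Path.trans_apply]
      simp only [Function.comp]
      split_ifs with h
      · have hs2 : (s : ℝ) = 1 / 2 := le_antisymm h hs'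
        rw [show (⟨2 * s, _⟩ : unitInterval) = 1 from Subtype.ext (by simp [hs2]),
          show (⟨max (2 * s - 1 : ℝ) 0, hp s⟩ : unitInterval) = 0 from
            Subtype.ext (by simp [hs2]), γ.target, γ'.source]
      · congr 2
        exact (max_eq_left (by linarith)).symm
    rw [eVariationOn.congr h1]
    refine (eVariationOn.comp_le_of_monotoneOn _ _ ?_ (mapsTo_univ _ _)).trans (by rw [← hu])
    intro s _ t _ hst
    have : (s : ℝ) ≤ t := hst
    exact Subtype.mk_le_mk.2 (max_le_max_right _ (by linarith))

theorem eVariationOn_le_of_dist_le {X : Type*} [PseudoMetricSpace X] {f : unitInterval → X} {K : ℝ}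
    (hK : 0 ≤ K) (h : ∀ s t, dist (f s) (f t) ≤ K * dist s t) :
    eVariationOn f univ ≤ ENNReal.ofReal K := by
  have hL : LipschitzOnWith K.toNNReal f univ :=
    (LipschitzWith.of_dist_le_mul fun s t => by rw [Real.coe_toNNReal K hK]; exact h s t)
      |>.lipschitzOnWith
  have h1 := hL.comp_eVariationOn_le (f := f) (g := id) (s := univ) (mapsTo_univ _ _)
  have h2 : eVariationOn (Subtype.val : unitInterval → ℝ) univ ≤ 1 := by
    have := MonotoneOn.eVariationOn_eq (f := (Subtype.val : unitInterval → ℝ)) (s := univ)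
      (fun a _ b _ hab => hab) (mem_univ 0) (mem_univ 1)
    have hI : (univ : Set unitInterval) ∩ Icc 0 1 = univ := by
      ext s; simpa using unitInterval.le_one'
    rw [hI] at this
    simpa using this.le
  calc eVariationOn f univ ≤ _ := h1
    _ ≤ ENNReal.ofReal K * 1 := by
        refine mul_le_mul' le_rfl ?_
        exact h2
    _ = _ := mul_one _

/-- A compact Hausdorff connected space covered by finitely many continuous images of a compact
geodesic space carries a geodesic metric for which these maps are `c`-Lipschitz, provided that the
functions that are Lipschitz along these maps separate the points. -/
theorem exists_isGeodesicMetric_of_cover [Finite ι] [t : TopologicalSpace X] [PreconnectedSpace X]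
    [CompactSpace X] [T2Space X] [CompactSpace Q] (hQ : HasGeodesics Q) (hc : 0 < c)
    (hP : ∀ i, Continuous (P i)) (hcov : ∀ p, ∃ i a, P i a = p)
    (hsep : ∀ p q : X, p ≠ q → ∃ (φ : X → ℝ) (K : ℝ), 0 ≤ K ∧
      (∀ i a b, |φ (P i a) - φ (P i b)| ≤ K * dist a b) ∧ φ p ≠ φ q) :
    ∃ m : MetricSpace X, IsGeodesicMetric m ∧ ∀ p q, m.dist p q = chainDist P c p q := by
  have hex := exists_chainCost (c := c) hP hcov
  have hself : ∀ p, chainDist P c p p = 0 := fun p =>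
    le_antisymm (chainDist_le hc.le (.refl p)) (le_csInf (hex p p) fun _ h => h.nonneg hc.le)
  have hpos : ∀ p q, chainDist P c p q = 0 → p = q := by
    intro p q h0
    by_contra hne
    obtain ⟨φ, K, hK, hφ, hpq⟩ := hsep p q hne
    have := abs_sub_le_chainDist (c := c) (K := K / c) (by positivity) (fun i a b => by
      have := hφ i a b
      field_simp
      linarith) (hex p q)
    rw [h0, mul_zero] at this
    exact hpq (sub_eq_zero.1 (abs_nonpos_iff.1 this))
  let m₀ : MetricSpace X :=
    { dist := chainDist P c
      dist_self := hself
      dist_comm := chainDist_comm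
      dist_triangle := chainDist_triangle hc.le hex
      eq_of_dist_eq_zero := hpos _ _ }
  have hball : ∀ p q : X, m₀.dist p q = chainDist P c p q := fun _ _ => rfl
  -- A continuous map from a compact space onto a Hausdorff one is a quotient map, so continuity of
  -- the chain distance may be tested on each piece, where it is Lipschitz.
  have hquot : IsQuotientMap (fun a : Σ _ : ι, Q => P a.1 a.2) := by
    have hcont : Continuous (fun a : Σ _ : ι, Q => P a.1 a.2) := continuous_sigma fun i => hP i
    refine hcont.isClosedMap.isQuotientMap hcont fun p => ?_
    obtain ⟨i, a, h⟩ := hcov p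
    exact ⟨⟨i, a⟩, h⟩
  have hD : ∀ p, Continuous fun q => chainDist P c q p := by
    intro p
    refine hquot.continuous_iff.2 (continuous_sigma fun i => ?_)
    refine (LipschitzWith.of_dist_le_mul (K := c.toNNReal) fun a b => ?_).continuous
    rw [Real.coe_toNNReal c hc.le, Real.dist_eq]
    refine le_trans ?_ (chainDist_map_le (P := P) hc.le i a b)
    have h1 := chainDist_triangle hc.le hex (P i a) (P i b) p
    have h2 := chainDist_triangle hc.le hex (P i b) (P i a) p
    rw [chainDist_comm (P i b) (P i a)] at h2
    exact abs_sub_le_iff.2 ⟨by dsimp; linarith, by dsimp; linarith⟩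
  have hid : @Continuous X X t m₀.toPseudoMetricSpace.toUniformSpace.toTopologicalSpace id := by
    refine (@Metric.continuous_iff' X X m₀.toPseudoMetricSpace t id).2 fun p ε hε => ?_
    exact (hD p).continuousAt.eventually_lt continuousAt_const (by rwa [hself])
  have htop : t = m₀.toPseudoMetricSpace.toUniformSpace.toTopologicalSpace := by
    -- The identity is a continuous bijection from a compact topology to a Hausdorff one. The
    -- general facts are stated for other types, to keep the two topologies on `X` apart.
    have ht2 : ∀ {Y : Type _} [MetricSpace Y], T2Space Y := inferInstance
    have hind : ∀ {Y Z : Type _} [s : TopologicalSpace Y] [s' : TopologicalSpace Z]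
        [CompactSpace Y] [T2Space Z] {f : Y → Z}, Continuous f → Function.Injective f →
        s = s'.induced f := fun hf hinj => (hf.isClosedEmbedding hinj).isInducing.eq_induced
    have := @hind X X t m₀.toPseudoMetricSpace.toUniformSpace.toTopologicalSpace _ (@ht2 X m₀) id
      hid Function.injective_id
    exact this.trans (@induced_id X m₀.toPseudoMetricSpace.toUniformSpace.toTopologicalSpace)
  refine ⟨m₀.replaceTopology htop, ⟨rfl, ?_⟩, hball⟩
  let m₁ : MetricSpace X := m₀.replaceTopology htop
  have hdist : ∀ p q : X, dist p q = chainDist P c p q := fun _ _ => rfl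
  intro p q
  refine le_antisymm (le_iInf fun γ => ?_) ?_
  · have := eVariationOn.edist_le (γ : unitInterval → X) (mem_univ 0) (mem_univ 1)
    rwa [γ.source, γ.target] at this
  -- Replacing each link of a chain by the image of a geodesic of `Q` gives a path no longer than
  -- the cost of the chain.
  · have key : ∀ {p q : X} {ℓ : ℝ}, ChainCost P c p q ℓ →
        ∃ γ : Path p q, eVariationOn γ univ ≤ ENNReal.ofReal ℓ := by
      intro p q ℓ h
      induction h with
      | refl =>
        refine ⟨Path.refl p, ?_⟩
        rw [eVariationOn.constant_on]
        · exact zero_le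
        · rintro _ ⟨s, -, rfl⟩ _ ⟨s', -, rfl⟩
          rfl
      | @step ℓ i a b h ih =>
        obtain ⟨γ, hγ⟩ := ih
        obtain ⟨δ, hδ⟩ := hQ a b
        refine ⟨γ.trans (δ.map (hP i)), (eVariationOn_path_trans_le _ _).trans ?_⟩
        rw [ENNReal.ofReal_add (h.nonneg hc.le) (by positivity)]
        refine add_le_add hγ (eVariationOn_le_of_dist_le (by positivity) fun s t => ?_)
        refine (chainDist_map_le hc.le i (δ s) (δ t)).trans ?_
        rw [mul_assoc]
        exact mul_le_mul_of_nonneg_left (hδ s t) hc.le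
    refine ENNReal.le_of_forall_pos_le_add fun ε hε _ => ?_
    obtain ⟨ℓ, hℓ, h⟩ := exists_lt_of_csInf_lt (hex p q)
      (show chainDist P c p q < chainDist P c p q + ε by
        have : (0 : ℝ) < ε := hε
        linarith)
    obtain ⟨γ, hγ⟩ := key hℓ
    refine (iInf_le _ γ).trans (hγ.trans ?_)
    rw [edist_dist, ← ENNReal.ofReal_coe_nnreal,
      ← ENNReal.ofReal_add dist_nonneg ε.coe_nonneg, hdist]
    exact ENNReal.ofReal_le_ofReal h.le

end QuotientMetric

/-! ### Geodesic metrics adapted to a polygonal tiling -/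

section SidePoint

theorem norm_sidePoint (n j : ℕ) (t : ℝ) : ‖sidePoint n j t‖ = 1 :=
  Complex.norm_exp_ofReal_mul_I _

theorem continuous_sidePoint (n j : ℕ) : Continuous (sidePoint n j) := by
  unfold sidePoint
  fun_prop

theorem exists_sidePoint_eq {n : ℕ} (hn : 0 < n) {z : ℂ} (hz : ‖z‖ = 1) :
    ∃ j < n, ∃ t : unitInterval, sidePoint n j t = z := by
  have hn' : (0 : ℝ) < n := Nat.cast_pos.2 hn
  -- The fractional part brings the angle, in full turns, into [0, 1). After multiplication by `n`,
  -- its integer part is the side and its fractional part the parameter on that side.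
  set θ := z.arg / (2 * Real.pi) with hθ
  have hτ0 : 0 ≤ n * Int.fract θ := mul_nonneg hn'.le (Int.fract_nonneg _)
  have hτ1 : n * Int.fract θ < n := by
    have := mul_lt_mul_of_pos_left (Int.fract_lt_one θ) hn'
    rwa [mul_one] at this
  refine ⟨⌊n * Int.fract θ⌋₊, (Nat.floor_lt hτ0).2 hτ1, ⟨n * Int.fract θ - ⌊n * Int.fract θ⌋₊,
    sub_nonneg.2 (Nat.floor_le hτ0), ?_⟩, ?_⟩
  · linarith [Nat.lt_floor_add_one (n * Int.fract θ)]
  · have hz' : z = Complex.exp (z.arg * Complex.I) := by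
      have := Complex.norm_mul_exp_arg_mul_I z
      rw [hz] at this
      simpa using this.symm
    conv_rhs => rw [hz']
    rw [sidePoint, Complex.exp_eq_exp_iff_exists_int]
    refine ⟨-⌊θ⌋, ?_⟩
    have h1 : 2 * Real.pi * ((⌊n * Int.fract θ⌋₊ + (n * Int.fract θ - ⌊n * Int.fract θ⌋₊)) / n) =
        z.arg - 2 * Real.pi * ⌊θ⌋ := by
      rw [add_sub_cancel, mul_div_cancel_left₀ _ hn'.ne', Int.fract, mul_sub, hθ,
        mul_div_cancel₀ _ Real.two_pi_pos.ne']
    rw [h1]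
    push_cast
    ring

theorem norm_exp_mul_I_sub_le (a b : ℝ) :
    ‖Complex.exp (a * Complex.I) - Complex.exp (b * Complex.I)‖ ≤ |a - b| := by
  have h1 : Complex.exp (a * Complex.I) - Complex.exp (b * Complex.I) =
      Complex.exp (b * Complex.I) * (Complex.exp (Complex.I * ((a - b : ℝ) : ℂ)) - 1) := by
    rw [mul_sub, ← Complex.exp_add, mul_one]
    congr 2
    push_cast
    ring
  rw [h1, norm_mul, Complex.norm_exp_ofReal_mul_I, one_mul]
  exact Real.norm_exp_I_mul_ofReal_sub_one_le

theorem norm_sidePoint_sub_le {n : ℕ} (hn : 0 < n) (j : ℕ) (t t' : ℝ) :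
    ‖sidePoint n j t - sidePoint n j t'‖ ≤ 2 * Real.pi * |t - t'| := by
  have hn1 : (1 : ℝ) ≤ n := by exact_mod_cast hn
  refine (norm_exp_mul_I_sub_le _ _).trans ?_
  rw [← mul_sub, ← sub_div, add_sub_add_left_eq_sub, abs_mul, abs_of_pos Real.two_pi_pos, abs_div,
    Nat.abs_cast]
  exact mul_le_mul_of_nonneg_left (div_le_self (abs_nonneg _) hn1) Real.two_pi_pos.le

end SidePoint

namespace PolygonalTiling

variable {V F X : Type*} [TopologicalSpace X] (T : PolygonalTiling V F X)

theorem sides_pos (f : F) : 0 < T.sides f := lt_of_lt_of_le (by norm_num) (T.three_le_sides f)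

theorem edge_eq_vertex {x y z : V} {h : T.graph.Adj x y} {s : unitInterval}
    (he : T.edge h s = T.vertex z) : (s = 0 ∧ z = x) ∨ (s = 1 ∧ z = y) := by
  by_cases h0 : s = 0
  · subst h0
    rw [(T.edge h).source] at he
    exact Or.inl ⟨rfl, (T.vertex_injective he).symm⟩
  by_cases h1 : s = 1
  · subst h1
    rw [(T.edge h).target] at he
    exact Or.inr ⟨rfl, (T.vertex_injective he).symm⟩
  exact absurd he (T.edge_ne_vertex h s z h0 h1)

theorem edge_symm_apply {x y : V} (h : T.graph.Adj x y) (s : unitInterval) :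
    T.edge h.symm s = T.edge h (unitInterval.symm s) := by
  rw [T.edge_symm h]; rfl

/-- Edges leaving the same vertex can share a point only at equal parameters; hence the choice in
`starCoord` does not matter. -/
theorem eq_of_edge_eq_edge {v y y' : V} {h : T.graph.Adj v y} {h' : T.graph.Adj v y'}
    {s s' : unitInterval} (he : T.edge h s = T.edge h' s') : s = s' := by
  by_cases h0 : s = 0
  · subst h0
    rw [(T.edge h).source] at he
    rcases T.edge_eq_vertex he.symm with ⟨rfl, -⟩ | ⟨-, h2⟩
    · rfl
    · exact absurd h2 h'.ne
  by_cases h1 : s = 1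
  · subst h1
    rw [(T.edge h).target] at he
    rcases T.edge_eq_vertex he.symm with ⟨-, h2⟩ | ⟨rfl, -⟩
    · exact absurd h2.symm h.ne
    · rfl
  · have h2 := T.edge_disjoint h h' s s' h0 h1 he
    rw [Sym2.congr_right] at h2
    subst h2
    exact T.edge_injective h he

/-! #### Functions on the 1-skeleton -/

open Classical in
/-- The function that is the parameter on the edges that leave `v` and is `1` elsewhere. -/
noncomputable def starCoord (v : V) (p : X) : ℝ :=
  if h : ∃ s : unitInterval, ∃ (y : V) (h : T.graph.Adj v y), T.edge h s = p then h.choose else 1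

theorem starCoord_edge_left {v y : V} (h : T.graph.Adj v y) (s : unitInterval) :
    T.starCoord v (T.edge h s) = s := by
  have hex : ∃ s' : unitInterval, ∃ (y' : V) (h' : T.graph.Adj v y'), T.edge h' s' = T.edge h s :=
    ⟨s, y, h, rfl⟩
  rw [starCoord, dif_pos hex]
  obtain ⟨y', h', he⟩ := hex.choose_spec
  rw [T.eq_of_edge_eq_edge he]

theorem starCoord_edge_right {x v : V} (h : T.graph.Adj x v) (s : unitInterval) :
    T.starCoord v (T.edge h s) = 1 - s := by
  have := T.starCoord_edge_left h.symm (unitInterval.symm s)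
  rwa [T.edge_symm_apply, unitInterval.symm_symm] at this

theorem starCoord_edge_of_ne {x y v : V} (h : T.graph.Adj x y) (s : unitInterval) (hx : x ≠ v)
    (hy : y ≠ v) : T.starCoord v (T.edge h s) = 1 := by
  unfold starCoord
  split_ifs with hex
  · obtain ⟨y', h', he⟩ := hex.choose_spec
    set s' := hex.choose
    by_cases h0 : s' = 0
    · rw [h0, (T.edge h').source] at he
      rcases T.edge_eq_vertex he.symm with ⟨-, h2⟩ | ⟨-, h2⟩
      exacts [absurd h2.symm hx, absurd h2.symm hy]
    by_cases h1 : s' = 1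
    · rw [h1]; rfl
    · have h2 := T.edge_disjoint h' h s' s h0 h1 he
      have : v ∈ s(x, y) := h2 ▸ Sym2.mem_mk_left v y'
      rcases Sym2.mem_iff.1 this with h2 | h2
      exacts [absurd h2.symm hx, absurd h2.symm hy]
  · rfl

theorem starCoord_mem (v : V) (p : X) : T.starCoord v p ∈ Icc (0 : ℝ) 1 := by
  unfold starCoord
  split_ifs with h
  · exact h.choose.2
  · exact ⟨zero_le_one, le_rfl⟩

theorem abs_starCoord_edge_sub_le (v : V) {x y : V} (h : T.graph.Adj x y) (s s' : unitInterval) :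
    |T.starCoord v (T.edge h s) - T.starCoord v (T.edge h s')| ≤ dist s s' := by
  rw [Subtype.dist_eq, Real.dist_eq]
  by_cases hx : x = v
  · subst hx
    rw [T.starCoord_edge_left, T.starCoord_edge_left]
  by_cases hy : y = v
  · subst hy
    rw [T.starCoord_edge_right, T.starCoord_edge_right, abs_sub_comm]
    simp
  · rw [T.starCoord_edge_of_ne h s hx hy, T.starCoord_edge_of_ne h s' hx hy]
    simp

/-- The star coordinate at `v` vanishes only at `v` on the 1-skeleton, which identifies vertices. An
interior point of an edge has coordinates below 1 at both ends, which determines the edge, and then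
the parameter. -/
theorem exists_starCoord_ne {x y x' y' : V} (h : T.graph.Adj x y) (h' : T.graph.Adj x' y')
    {s s' : unitInterval} (hne : T.edge h s ≠ T.edge h' s') :
    ∃ v, T.starCoord v (T.edge h s) ≠ T.starCoord v (T.edge h' s') := by
  by_contra! hall
  have hx := hall x
  have hy := hall y
  rw [T.starCoord_edge_left] at hx
  rw [T.starCoord_edge_right] at hy
  by_cases hs0 : s = 0
  · subst hs0
    by_cases h1 : x' = x
    · subst h1
      rw [T.starCoord_edge_left] at hx
      rw [← Subtype.ext hx, (T.edge h).source, (T.edge h').source] at hne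
      exact hne rfl
    by_cases h2 : y' = x
    · subst h2
      rw [T.starCoord_edge_right] at hx
      have hs' : s' = 1 := Subtype.ext (by
        have : (0 : ℝ) = 1 - s' := by simpa using hx
        rw [Set.Icc.coe_one]; linarith)
      rw [hs', (T.edge h).source, (T.edge h').target] at hne
      exact hne rfl
    rw [T.starCoord_edge_of_ne h' s' h1 h2] at hx
    simp at hx
  by_cases hs1 : s = 1
  · subst hs1
    by_cases h1 : x' = y
    · subst h1
      rw [T.starCoord_edge_left] at hy
      have hs' : s' = 0 := Subtype.ext (by simpa using hy.symm)
      rw [hs', (T.edge h).target, (T.edge h').source] at hne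
      exact hne rfl
    by_cases h2 : y' = y
    · subst h2
      rw [T.starCoord_edge_right] at hy
      have hs' : s' = 1 := Subtype.ext (by
        have : (0 : ℝ) = 1 - s' := by simpa using hy
        rw [Set.Icc.coe_one]; linarith)
      rw [hs', (T.edge h).target, (T.edge h').target] at hne
      exact hne rfl
    rw [T.starCoord_edge_of_ne h' s' h1 h2] at hy
    simp at hy
  -- Otherwise the coordinate at `x` would be 1, which an interior parameter excludes.
  have hx1 : x' = x ∨ y' = x := by
    by_contra! hc
    rw [T.starCoord_edge_of_ne h' s' hc.1 hc.2] at hx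
    exact hs1 (Subtype.ext (by simpa using hx))
  have hy1 : x' = y ∨ y' = y := by
    by_contra! hc
    rw [T.starCoord_edge_of_ne h' s' hc.1 hc.2] at hy
    exact hs0 (Subtype.ext (by simpa using hy))
  rcases hx1 with rfl | rfl
  · rcases hy1 with h1 | rfl
    · exact h.ne h1
    · rw [T.starCoord_edge_left] at hx
      rw [Subtype.ext hx] at hne
      exact hne rfl
  · rcases hy1 with rfl | h1
    · rw [T.starCoord_edge_right] at hx
      have hs : s = unitInterval.symm s' := Subtype.ext hx
      rw [hs, ← T.edge_symm_apply h] at hne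
      exact hne rfl
    · exact h.ne h1

theorem reachable_of_edge_eq {x y x' y' : V} {h : T.graph.Adj x y} {h' : T.graph.Adj x' y'}
    {s s' : unitInterval} (he : T.edge h s = T.edge h' s') : T.graph.Reachable x x' := by
  by_cases h0 : s = 0
  · subst h0
    rw [(T.edge h).source] at he
    rcases T.edge_eq_vertex he.symm with ⟨-, rfl⟩ | ⟨-, rfl⟩
    exacts [.refl _, h'.symm.reachable]
  by_cases h1 : s = 1
  · subst h1
    rw [(T.edge h).target] at he
    rcases T.edge_eq_vertex he.symm with ⟨-, rfl⟩ | ⟨-, rfl⟩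
    exacts [h.reachable, h.reachable.trans h'.symm.reachable]
  · have h2 := T.edge_disjoint h h' s s' h0 h1 he
    rcases Sym2.eq_iff.1 h2 with ⟨rfl, -⟩ | ⟨rfl, -⟩
    exacts [.refl _, h'.symm.reachable]

/-! #### Faces -/

theorem exists_chart_eq_edge (f : F) {z : ℂ} (hz : ‖z‖ = 1) :
    ∃ j < T.sides f, ∃ s : unitInterval, sidePoint (T.sides f) j s = z ∧
      T.chart f z = T.edge (T.corner_adj f j) s := by
  obtain ⟨j, hj, s, rfl⟩ := exists_sidePoint_eq (T.sides_pos f) hz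
  exact ⟨j, hj, s, rfl, T.chart_side f j s⟩

theorem exists_ball_or_edge (p : X) :
    (∃ f, ∃ z ∈ Metric.ball (0 : ℂ) 1, T.chart f z = p) ∨
      ∃ f, ∃ j < T.sides f, ∃ s : unitInterval, T.edge (T.corner_adj f j) s = p := by
  obtain ⟨f, z, hz, rfl⟩ := T.cover p
  rw [mem_closedBall_zero_iff] at hz
  rcases hz.lt_or_eq with hz | hz
  · exact Or.inl ⟨f, z, mem_ball_zero_iff.2 hz, rfl⟩
  · obtain ⟨j, hj, s, -, h⟩ := T.exists_chart_eq_edge f hz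
    exact Or.inr ⟨f, j, hj, s, h.symm⟩

theorem exists_side_eq_vertex (v : V) : ∃ f, ∃ j < T.sides f, v = T.corner f j ∨
    v = T.corner f (j + 1) := by
  rcases T.exists_ball_or_edge (T.vertex v) with ⟨f, z, hz, h⟩ | ⟨f, j, hj, s, h⟩
  · exact absurd h (T.chart_ne_vertex f z hz v)
  · rcases T.edge_eq_vertex h with ⟨-, h⟩ | ⟨-, h⟩
    exacts [⟨f, j, hj, Or.inl h⟩, ⟨f, j, hj, Or.inr h⟩]

theorem exists_adj (v : V) : ∃ y, T.graph.Adj v y := by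
  obtain ⟨f, j, -, rfl | rfl⟩ := T.exists_side_eq_vertex v
  exacts [⟨_, T.corner_adj f j⟩, ⟨_, (T.corner_adj f j).symm⟩]

/-- Every edge is a side of a face. -/
theorem exists_side_eq_edge {x y : V} (h : T.graph.Adj x y) : ∃ f, ∃ j < T.sides f,
    (∀ s, T.edge h s = T.edge (T.corner_adj f j) s) ∨
      ∀ s, T.edge h s = T.edge (T.corner_adj f j) (unitInterval.symm s) := by
  -- The midpoint lies on a side of some face, and an interior point belongs to only one edge.
  set m : unitInterval := ⟨1 / 2, by constructor <;> norm_num⟩ with hm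
  have hm0 : m ≠ 0 := fun h => by
    have := congrArg Subtype.val h
    norm_num [hm] at this
  have hm1 : m ≠ 1 := fun h => by
    have := congrArg Subtype.val h
    norm_num [hm] at this
  rcases T.exists_ball_or_edge (T.edge h m) with ⟨f, z, hz, he⟩ | ⟨f, j, hj, s, he⟩
  · exact absurd he (T.chart_ne_edge f z hz h m)
  refine ⟨f, j, hj, ?_⟩
  have key : ∀ {a b : V} (h' : T.graph.Adj a b), s(x, y) = s(a, b) →
      (∀ s, T.edge h s = T.edge h' s) ∨ ∀ s, T.edge h s = T.edge h' (unitInterval.symm s) := by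
    intro a b h' hab
    rcases Sym2.eq_iff.1 hab with ⟨rfl, rfl⟩ | ⟨rfl, rfl⟩
    · exact Or.inl fun s => rfl
    · exact Or.inr fun s => T.edge_symm_apply h' s
  exact key _ (T.edge_disjoint h _ m s hm0 hm1 he.symm)

theorem reachable_corner (f : F) (j : ℕ) : T.graph.Reachable (T.corner f 0) (T.corner f j) := by
  induction j with
  | zero => exact .refl _
  | succ j ih => exact ih.trans (T.corner_adj f j).reachable

/-- Different faces can meet only in the 1-skeleton, and the corners of one face lie in one
component of the graph. -/
theorem reachable_of_chart_eq {f g : F} {z z' : ℂ} (hz : z ∈ Metric.closedBall (0 : ℂ) 1)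
    (hz' : z' ∈ Metric.closedBall (0 : ℂ) 1) (h : T.chart f z = T.chart g z') :
    T.graph.Reachable (T.corner f 0) (T.corner g 0) := by
  rw [mem_closedBall_zero_iff] at hz hz'
  rcases hz.lt_or_eq with hz | hz <;> rcases hz'.lt_or_eq with hz' | hz'
  · rw [(T.chart_interior f g z (mem_ball_zero_iff.2 hz) z' (mem_ball_zero_iff.2 hz') h).1]
  · obtain ⟨j, -, s, -, h'⟩ := T.exists_chart_eq_edge g hz'
    exact absurd (h.trans h') (T.chart_ne_edge f z (mem_ball_zero_iff.2 hz) _ _)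
  · obtain ⟨j, -, s, -, h'⟩ := T.exists_chart_eq_edge f hz
    exact absurd (h.symm.trans h') (T.chart_ne_edge g z' (mem_ball_zero_iff.2 hz') _ _)
  · obtain ⟨j, -, s, -, h1⟩ := T.exists_chart_eq_edge f hz
    obtain ⟨j', -, s', -, h2⟩ := T.exists_chart_eq_edge g hz'
    exact (T.reachable_corner f j).trans ((T.reachable_of_edge_eq
      (h1.symm.trans (h.trans h2))).trans (T.reachable_corner g j').symm)

theorem reachable_of_chart_eq_vertex {f : F} {z : ℂ} (hz : z ∈ Metric.closedBall (0 : ℂ) 1) {v : V}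
    (h : T.chart f z = T.vertex v) : T.graph.Reachable (T.corner f 0) v := by
  rw [mem_closedBall_zero_iff] at hz
  rcases hz.lt_or_eq with hz | hz
  · exact absurd h (T.chart_ne_vertex f z (mem_ball_zero_iff.2 hz) v)
  · obtain ⟨j, -, s, -, h'⟩ := T.exists_chart_eq_edge f hz
    rcases T.edge_eq_vertex (h'.symm.trans h) with ⟨-, rfl⟩ | ⟨-, rfl⟩
    exacts [T.reachable_corner f j, T.reachable_corner f (j + 1)]

theorem isClosed_face [T2Space X] (f : F) : IsClosed (T.chart f '' Metric.closedBall (0 : ℂ) 1) :=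
  ((isCompact_closedBall 0 1).image_of_continuousOn (T.chart_continuousOn f)).isClosed

/-- The 1-skeleton of a tiling of a connected space is connected. -/
theorem reachable [Finite F] [T2Space X] [PreconnectedSpace X] (v w : V) :
    T.graph.Reachable v w := by
  obtain ⟨f₀, z₀, hz₀, h₀⟩ := T.cover (T.vertex v)
  -- The faces with corners in the component of those of `f₀` form a union that every other face
  -- misses, so it is clopen.
  have huniv : {p | ∃ f, T.graph.Reachable (T.corner f₀ 0) (T.corner f 0) ∧
      p ∈ T.chart f '' Metric.closedBall (0 : ℂ) 1} = univ := by
    refine eq_univ_of_finite_closed_cover (fun f => T.chart f '' Metric.closedBall (0 : ℂ) 1)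
      T.isClosed_face (fun p => ?_) _ ⟨_, f₀, .refl _, z₀, hz₀, h₀⟩ fun f => ?_
    · obtain ⟨f, z, hz, h⟩ := T.cover p
      exact ⟨f, z, hz, h⟩
    · by_cases hf : T.graph.Reachable (T.corner f₀ 0) (T.corner f 0)
      · exact Or.inl fun p hp => ⟨f, hf, hp⟩
      · right
        rintro _ ⟨z, hz, rfl⟩ ⟨g, hg, z', hz', h⟩
        exact hf (hg.trans (T.reachable_of_chart_eq hz' hz h))
  obtain ⟨f, hf, z, hz, h⟩ := huniv.symm.subset (mem_univ (T.vertex w))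
  exact ((T.reachable_of_chart_eq_vertex hz₀ h₀).symm.trans hf).trans
    (T.reachable_of_chart_eq_vertex hz h)

/-- The sector of the face `f` over its `j`-th side, in polar coordinates. -/
noncomputable def sector (i : Σ f : F, Fin (T.sides f)) (a : unitInterval × unitInterval) : X :=
  T.chart i.1 ((a.1 : ℝ) * sidePoint (T.sides i.1) i.2 a.2)

variable {T}

theorem norm_sector_coord (i : Σ f : F, Fin (T.sides f)) (a : unitInterval × unitInterval) :
    ‖((a.1 : ℝ) : ℂ) * sidePoint (T.sides i.1) i.2 a.2‖ = a.1 := by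
  rw [norm_mul, norm_sidePoint, mul_one, Complex.norm_real, Real.norm_of_nonneg a.1.2.1]

theorem sector_one (i : Σ f : F, Fin (T.sides f)) (s : unitInterval) :
    T.sector i (1, s) = T.edge (T.corner_adj i.1 i.2) s := by
  rw [sector, ← T.chart_side]
  simp

theorem continuous_sector (i : Σ f : F, Fin (T.sides f)) : Continuous (T.sector i) := by
  refine (T.chart_continuousOn i.1).comp_continuous ?_ fun a => ?_
  · have := continuous_sidePoint (T.sides i.1) i.2
    fun_prop
  · rw [mem_closedBall_zero_iff, norm_sector_coord]
    exact a.1.2.2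

theorem exists_sector_coord_eq (f : F) {z : ℂ} (hz : z ∈ Metric.closedBall (0 : ℂ) 1) :
    ∃ (j : Fin (T.sides f)) (a : unitInterval × unitInterval),
      ((a.1 : ℝ) : ℂ) * sidePoint (T.sides f) j a.2 = z := by
  rw [mem_closedBall_zero_iff] at hz
  by_cases h0 : z = 0
  · exact ⟨⟨0, T.sides_pos f⟩, (0, 0), by simp [h0]⟩
  have hn : ‖z‖ ≠ 0 := norm_ne_zero_iff.2 h0
  obtain ⟨j, hj, t, h⟩ := exists_sidePoint_eq (T.sides_pos f) (z := z / ‖z‖) (by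
    rw [norm_div, Complex.norm_real, norm_norm, div_self hn])
  refine ⟨⟨j, hj⟩, (⟨‖z‖, norm_nonneg z, hz⟩, t), ?_⟩
  change ((‖z‖ : ℝ) : ℂ) * sidePoint (T.sides f) j t = z
  rw [h, mul_div_cancel₀ _ (Complex.ofReal_ne_zero.2 hn)]

theorem exists_sector_eq (p : X) : ∃ i a, T.sector i a = p := by
  obtain ⟨f, z, hz, rfl⟩ := T.cover p
  obtain ⟨j, a, h⟩ := exists_sector_coord_eq (T := T) f hz
  exact ⟨⟨f, j⟩, a, by rw [sector]; exact congrArg _ h⟩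

/-- The radial motion contributes 1 and the angular motion at most 2π to the Lipschitz constant. -/
theorem norm_sector_coord_sub_le (i : Σ f : F, Fin (T.sides f))
    (a b : unitInterval × unitInterval) :
    ‖((a.1 : ℝ) : ℂ) * sidePoint (T.sides i.1) i.2 a.2 -
      ((b.1 : ℝ) : ℂ) * sidePoint (T.sides i.1) i.2 b.2‖ ≤ (1 + 2 * Real.pi) * dist a b := by
  have h1 : dist a.1 b.1 ≤ dist a b := le_max_left _ _
  have h2 : dist a.2 b.2 ≤ dist a b := le_max_right _ _
  rw [Subtype.dist_eq, Real.dist_eq] at h1 h2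
  have h3 := norm_sidePoint_sub_le (T.sides_pos i.1) i.2 a.2 b.2
  set p := sidePoint (T.sides i.1) i.2 a.2 with hp
  set q := sidePoint (T.sides i.1) i.2 b.2
  calc ‖((a.1 : ℝ) : ℂ) * p - ((b.1 : ℝ) : ℂ) * q‖
      = ‖(((a.1 : ℝ) - (b.1 : ℝ) : ℝ) : ℂ) * p + ((b.1 : ℝ) : ℂ) * (p - q)‖ := by
        push_cast; ring_nf
    _ ≤ |(a.1 : ℝ) - b.1| + ‖p - q‖ := by
        refine (norm_add_le _ _).trans (add_le_add ?_ ?_)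
        · rw [norm_mul, Complex.norm_real, hp, norm_sidePoint, mul_one, Real.norm_eq_abs]
        · rw [norm_mul, Complex.norm_real, Real.norm_of_nonneg b.1.2.1]
          exact mul_le_of_le_one_left (norm_nonneg _) b.1.2.2
    _ ≤ dist a b + 2 * Real.pi * dist a b :=
        add_le_add h1 (h3.trans (mul_le_mul_of_nonneg_left h2 Real.two_pi_pos.le))
    _ = _ := by ring

variable (T)

/-! #### Lipschitz functions on the tiled space -/

open Classical in
/-- The extension of a function on the 1-skeleton with values in `[0, 1]` to the faces: it is
the maximum of the value at the radial projection to the boundary and the distance from the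
boundary. -/
noncomputable def radialExtension (ψ : X → ℝ) (p : X) : ℝ :=
  if h : ∃ a : F × ℂ, a.2 ∈ Metric.ball (0 : ℂ) 1 ∧ T.chart a.1 a.2 = p then
    max (ψ (T.chart h.choose.1 (h.choose.2 / ‖h.choose.2‖))) (1 - ‖h.choose.2‖) else ψ p

variable {T}

theorem radialExtension_edge (ψ : X → ℝ) {x y : V} (h : T.graph.Adj x y) (s : unitInterval) :
    T.radialExtension ψ (T.edge h s) = ψ (T.edge h s) := by
  rw [radialExtension, dif_neg]
  rintro ⟨a, ha, he⟩
  exact T.chart_ne_edge _ _ ha h s he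

theorem radialExtension_chart (ψ : X → ℝ) (f : F) {z : ℂ} (hz : z ∈ Metric.ball (0 : ℂ) 1) :
    T.radialExtension ψ (T.chart f z) = max (ψ (T.chart f (z / ‖z‖))) (1 - ‖z‖) := by
  have hex : ∃ a : F × ℂ, a.2 ∈ Metric.ball (0 : ℂ) 1 ∧ T.chart a.1 a.2 = T.chart f z :=
    ⟨(f, z), hz, rfl⟩
  rw [radialExtension, dif_pos hex]
  obtain ⟨h1, h2⟩ := T.chart_interior _ _ _ hex.choose_spec.1 _ hz hex.choose_spec.2
  rw [h1, h2]

/-- In polar coordinates the extension is the maximum of a function of the angle and one of the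
radius, so it loses nothing in the Lipschitz constant for the sup metric. The radial term hides the
discontinuity of the angle at the centre. -/
theorem radialExtension_sector {ψ : X → ℝ} (hψ : ∀ p, ψ p ∈ Icc (0 : ℝ) 1)
    (i : Σ f : F, Fin (T.sides f)) (a : unitInterval × unitInterval) :
    T.radialExtension ψ (T.sector i a) =
      max (ψ (T.edge (T.corner_adj i.1 i.2) a.2)) (1 - a.1) := by
  obtain ⟨r, t⟩ := a
  rcases r.2.2.lt_or_eq with hr | hr
  · have hz : ((r : ℝ) : ℂ) * sidePoint (T.sides i.1) i.2 t ∈ Metric.ball (0 : ℂ) 1 := by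
      rw [mem_ball_zero_iff, norm_sector_coord i (r, t)]
      exact hr
    rw [sector, radialExtension_chart ψ i.1 hz, norm_sector_coord i (r, t)]
    rcases r.2.1.eq_or_lt with h0 | h0
    -- At the centre the radial projection is the junk value `0 / 0 = 0`; since ψ ≤ 1, the maximum
    -- is 1 anyway.
    · simp only [← h0, sub_zero]
      rw [max_eq_right (hψ _).2, max_eq_right (hψ _).2]
    · have h0' : ((r : ℝ) : ℂ) ≠ 0 := Complex.ofReal_ne_zero.2 h0.ne'
      simp only [mul_div_cancel_left₀ _ h0']
      rw [T.chart_side]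
  · have : r = 1 := Subtype.ext hr
    subst this
    rw [sector_one, radialExtension_edge]
    simp [(hψ _).1]

theorem abs_radialExtension_starCoord_sub_le (v : V) (i : Σ f : F, Fin (T.sides f))
    (a b : unitInterval × unitInterval) :
    |T.radialExtension (T.starCoord v) (T.sector i a) -
      T.radialExtension (T.starCoord v) (T.sector i b)| ≤ dist a b := by
  rw [radialExtension_sector (T.starCoord_mem v), radialExtension_sector (T.starCoord_mem v)]
  refine (abs_max_sub_max_le_max _ _ _ _).trans (max_le_max ?_ ?_) |>.trans
    (max_comm _ _).le
  · exact T.abs_starCoord_edge_sub_le v _ _ _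
  · rw [Subtype.dist_eq, Real.dist_eq, abs_sub_comm]
    simp

variable (T) in
open Classical in
/-- The function supported in the interior of the face `f` that is `δ - |z - z₀|` in the
coordinate `z` near `z₀`. -/
noncomputable def faceBump (f : F) (z₀ : ℂ) (δ : ℝ) (p : X) : ℝ :=
  if h : ∃ z ∈ Metric.ball (0 : ℂ) 1, T.chart f z = p then max 0 (δ - ‖h.choose - z₀‖) else 0

/-- The bound on δ makes the bump vanish on the boundary circle, so that extension by 0 is
consistent there. -/
theorem faceBump_chart {f : F} {z₀ : ℂ} {δ : ℝ} (hδ : δ ≤ 1 - ‖z₀‖) {z : ℂ}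
    (hz : z ∈ Metric.closedBall (0 : ℂ) 1) :
    T.faceBump f z₀ δ (T.chart f z) = max 0 (δ - ‖z - z₀‖) := by
  rw [mem_closedBall_zero_iff] at hz
  rcases hz.lt_or_eq with hz | hz
  · have hex : ∃ z' ∈ Metric.ball (0 : ℂ) 1, T.chart f z' = T.chart f z :=
      ⟨z, mem_ball_zero_iff.2 hz, rfl⟩
    rw [faceBump, dif_pos hex, (T.chart_interior _ _ _ hex.choose_spec.1 _
      (mem_ball_zero_iff.2 hz) hex.choose_spec.2).2]
  · rw [faceBump, dif_neg, max_eq_left]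
    · have := norm_sub_norm_le z z₀
      linarith
    · rintro ⟨z', hz', h⟩
      obtain ⟨j, -, s, -, h'⟩ := T.exists_chart_eq_edge f hz
      exact T.chart_ne_edge f z' hz' _ _ (h.trans h')

theorem faceBump_chart_of_ne {f g : F} (hfg : f ≠ g) (z₀ : ℂ) (δ : ℝ) {z : ℂ}
    (hz : z ∈ Metric.closedBall (0 : ℂ) 1) : T.faceBump f z₀ δ (T.chart g z) = 0 := by
  rw [faceBump, dif_neg]
  rintro ⟨z', hz', h⟩
  rw [mem_closedBall_zero_iff] at hz
  rcases hz.lt_or_eq with hz | hz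
  · exact hfg (T.chart_interior _ _ _ hz' _ (mem_ball_zero_iff.2 hz) h).1
  · obtain ⟨j, -, s, -, h'⟩ := T.exists_chart_eq_edge g hz
    exact T.chart_ne_edge f z' hz' _ _ (h.trans h')

theorem abs_faceBump_sub_le {f : F} {z₀ : ℂ} {δ : ℝ} (hδ : δ ≤ 1 - ‖z₀‖)
    (i : Σ f : F, Fin (T.sides f)) (a b : unitInterval × unitInterval) :
    |T.faceBump f z₀ δ (T.sector i a) - T.faceBump f z₀ δ (T.sector i b)| ≤
      (1 + 2 * Real.pi) * dist a b := by
  have hmem : ∀ a : unitInterval × unitInterval,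
      ((a.1 : ℝ) : ℂ) * sidePoint (T.sides i.1) i.2 a.2 ∈ Metric.closedBall (0 : ℂ) 1 := by
    intro a
    rw [mem_closedBall_zero_iff, norm_sector_coord]
    exact a.1.2.2
  by_cases hf : f = i.1
  · subst hf
    rw [sector, sector, faceBump_chart hδ (hmem a), faceBump_chart hδ (hmem b)]
    refine (abs_max_sub_max_le_max _ _ _ _).trans (max_le ?_ ?_)
    · simp only [sub_self, abs_zero]
      positivity
    · rw [sub_sub_sub_cancel_left]
      refine (abs_norm_sub_norm_le _ _).trans ?_
      rw [sub_sub_sub_cancel_right, norm_sub_rev]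
      exact norm_sector_coord_sub_le i a b
  · rw [sector, sector, faceBump_chart_of_ne hf _ _ (hmem a), faceBump_chart_of_ne hf _ _ (hmem b)]
    simp only [sub_self, abs_zero]
    positivity

/-- A bump at `z₀` is positive there and vanishes on the other faces. In the same face its radius is
taken at most `‖z - z₀‖`, so that it vanishes at `z`. -/
theorem exists_separating_of_ball {f : F} {z₀ : ℂ} (hz₀ : z₀ ∈ Metric.ball (0 : ℂ) 1) {q : X}
    (hq : q ≠ T.chart f z₀) : ∃ (φ : X → ℝ) (K : ℝ), 0 ≤ K ∧
      (∀ i a b, |φ (T.sector i a) - φ (T.sector i b)| ≤ K * dist a b) ∧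
        φ (T.chart f z₀) ≠ φ q := by
  obtain ⟨g, z, hz, rfl⟩ := T.cover q
  have hz₀' := Metric.ball_subset_closedBall hz₀
  have hpos : 0 < 1 - ‖z₀‖ := sub_pos.2 (mem_ball_zero_iff.1 hz₀)
  by_cases hfg : f = g
  · subst hfg
    have hne : z ≠ z₀ := fun h => hq (by rw [h])
    have hn : 0 < ‖z - z₀‖ := norm_pos_iff.2 (sub_ne_zero.2 hne)
    have hδ : min (1 - ‖z₀‖) ‖z - z₀‖ ≤ 1 - ‖z₀‖ := min_le_left _ _
    refine ⟨T.faceBump f z₀ (min (1 - ‖z₀‖) ‖z - z₀‖), 1 + 2 * Real.pi, by positivity,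
      abs_faceBump_sub_le hδ, ?_⟩
    rw [faceBump_chart hδ hz₀', faceBump_chart hδ hz,
      max_eq_left (a := 0) (sub_nonpos.2 (min_le_right _ _)), sub_self, norm_zero, sub_zero]
    exact ne_of_gt (lt_max_of_lt_right (lt_min hpos hn))
  · refine ⟨T.faceBump f z₀ (1 - ‖z₀‖), 1 + 2 * Real.pi, by positivity,
      abs_faceBump_sub_le le_rfl, ?_⟩
    rw [faceBump_chart le_rfl hz₀', faceBump_chart_of_ne hfg _ _ hz, sub_self, norm_zero, sub_zero]
    exact ne_of_gt (lt_max_of_lt_right hpos)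

theorem exists_separating {p q : X} (hpq : p ≠ q) : ∃ (φ : X → ℝ) (K : ℝ), 0 ≤ K ∧
    (∀ i a b, |φ (T.sector i a) - φ (T.sector i b)| ≤ K * dist a b) ∧ φ p ≠ φ q := by
  rcases T.exists_ball_or_edge p with ⟨f, z, hz, rfl⟩ | ⟨f, j, -, s, rfl⟩
  · exact exists_separating_of_ball hz hpq.symm
  rcases T.exists_ball_or_edge q with ⟨g, z, hz, rfl⟩ | ⟨g, j', -, s', rfl⟩
  · obtain ⟨φ, K, hK, hφ, hne⟩ := exists_separating_of_ball hz hpq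
    exact ⟨φ, K, hK, hφ, hne.symm⟩
  obtain ⟨v, hv⟩ := T.exists_starCoord_ne _ _ hpq
  refine ⟨T.radialExtension (T.starCoord v), 1, zero_le_one, fun i a b => ?_, ?_⟩
  · rw [one_mul]
    exact abs_radialExtension_starCoord_sub_le v i a b
  · rwa [radialExtension_edge, radialExtension_edge]

variable (T)

/-- A tiled compact connected Hausdorff space carries a geodesic metric for which all the edges
are geodesic segments of the same given length. -/
theorem exists_isGeodesicMetric_hasConstantEdgeLength [Finite F] [CompactSpace X] [T2Space X]
    [PreconnectedSpace X] {c : ℝ} (hc : 0 < c) :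
    ∃ m : MetricSpace X, IsGeodesicMetric m ∧ T.HasConstantEdgeLength m c := by
  obtain ⟨m, hm, hdist⟩ := exists_isGeodesicMetric_of_cover (P := T.sector)
    (hasGeodesics_unitInterval.prod hasGeodesics_unitInterval) hc continuous_sector
    exists_sector_eq fun p q => exists_separating
  refine ⟨m, hm, fun {x y} h s s' => ?_⟩
  rw [hdist]
  have hreal : ∀ s s' : unitInterval, |(s : ℝ) - s'| = dist s s' := fun s s' => by
    rw [Subtype.dist_eq, Real.dist_eq]
  refine le_antisymm ?_ ?_
  · obtain ⟨f, j, hj, he⟩ := T.exists_side_eq_edge h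
    have hle : ∀ s s' : unitInterval, chainDist T.sector c (T.edge (T.corner_adj f j) s)
        (T.edge (T.corner_adj f j) s') ≤ c * |(s : ℝ) - s'| := by
      intro s s'
      have := chainDist_map_le (P := T.sector) hc.le ⟨f, ⟨j, hj⟩⟩ (1, s) (1, s')
      rw [sector_one, sector_one, Prod.dist_eq, dist_self, max_eq_right dist_nonneg,
        ← hreal] at this
      exact this
    rcases he with he | he
    · rw [he, he]
      exact hle s s'
    · rw [he, he]
      refine (hle _ _).trans_eq ?_
      rw [unitInterval.coe_symm_eq, unitInterval.coe_symm_eq, sub_sub_sub_cancel_left, abs_sub_comm]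
  -- On this edge the star coordinate at `x` is the parameter itself, and its extension is
  -- 1-Lipschitz along every sector.
  · have := abs_sub_le_chainDist (P := T.sector) (c := c) (K := 1 / c) (by positivity)
      (φ := T.radialExtension (T.starCoord x)) (fun i a b => by
        rw [← mul_assoc, one_div_mul_cancel hc.ne', one_mul]
        exact abs_radialExtension_starCoord_sub_le x i a b)
      (exists_chainCost (c := c) continuous_sector exists_sector_eq (T.edge h s) (T.edge h s'))
    rw [radialExtension_edge, radialExtension_edge, T.starCoord_edge_left,
      T.starCoord_edge_left, div_mul_eq_mul_div, one_mul, le_div_iff₀ hc] at this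
    linarith

end PolygonalTiling

/-! ### The curvature of an edge in a graph of girth greater than five -/

section Curvature

variable {V : Type*} {G : SimpleGraph V}

/-! ### Short cycles and the distances around an edge -/

theorem not_adj_of_common_neighbor (hg : 5 < G.egirth) {x y z : V} (hxy : G.Adj x y)
    (hyz : G.Adj y z) : ¬ G.Adj z x := by
  intro hzx
  let c : G.Walk x x := .cons hxy (.cons hyz (.cons hzx .nil))
  have hc : c.IsCycle := by
    rw [SimpleGraph.Walk.isCycle_def, SimpleGraph.Walk.isTrail_def]
    have := hxy.ne; have := hyz.ne; have := hzx.ne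
    simp [c]
    grind
  have := hg.trans_le (SimpleGraph.le_egirth.1 le_rfl _ c hc)
  simp [c] at this
  exact absurd this (by decide)

theorem not_exists_four_cycle (hg : 5 < G.egirth) {a b c d : V} (hab : G.Adj a b)
    (hbc : G.Adj b c) (hcd : G.Adj c d) (hac : a ≠ c) (hbd : b ≠ d) : ¬ G.Adj d a := by
  intro hda
  let w : G.Walk a a := .cons hab (.cons hbc (.cons hcd (.cons hda .nil)))
  have hc : w.IsCycle := by
    rw [SimpleGraph.Walk.isCycle_def, SimpleGraph.Walk.isTrail_def]
    have := hab.ne; have := hbc.ne; have := hcd.ne; have := hda.ne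
    simp [w]
    grind
  have := hg.trans_le (SimpleGraph.le_egirth.1 le_rfl _ w hc)
  simp [w] at this
  exact absurd this (by decide)

theorem not_exists_five_cycle (hg : 5 < G.egirth) {a b c d e : V} (hab : G.Adj a b)
    (hbc : G.Adj b c) (hcd : G.Adj c d) (hde : G.Adj d e) (hac : a ≠ c) (had : a ≠ d)
    (hbd : b ≠ d) (hbe : b ≠ e) (hce : c ≠ e) : ¬ G.Adj e a := by
  intro hea
  let w : G.Walk a a := .cons hab (.cons hbc (.cons hcd (.cons hde (.cons hea .nil))))
  have hc : w.IsCycle := by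
    rw [SimpleGraph.Walk.isCycle_def, SimpleGraph.Walk.isTrail_def]
    have := hab.ne; have := hbc.ne; have := hcd.ne; have := hde.ne; have := hea.ne
    simp [w]
    grind
  have := hg.trans_le (SimpleGraph.le_egirth.1 le_rfl _ w hc)
  simp [w] at this

/-- Reachability matters because `G.dist` is 0 on unreachable pairs. -/
theorem two_le_dist {u v : V} (hr : G.Reachable u v) (hne : u ≠ v) (hadj : ¬ G.Adj u v) :
    2 ≤ G.dist u v := by
  have h0 := hr.pos_dist_of_ne hne
  have h1 : G.dist u v ≠ 1 := fun h => hadj (SimpleGraph.dist_eq_one_iff_adj.1 h)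
  omega

theorem three_le_dist {u v : V} (hr : G.Reachable u v) (hne : u ≠ v) (hadj : ¬ G.Adj u v)
    (hcom : ∀ z, G.Adj u z → ¬ G.Adj z v) : 3 ≤ G.dist u v := by
  have h2 := two_le_dist hr hne hadj
  by_contra h3
  have : G.dist u v = 2 := by omega
  obtain ⟨w, hw⟩ := hr.exists_walk_length_eq_dist
  rw [this] at hw
  match w, hw with
  | .cons h (.cons h' .nil), _ => exact hcom _ h h'

open Classical in
/-- A function that witnesses the Wasserstein distance of the lazy steps at the end points of the
edge `x y`. -/
noncomputable def edgePotential (G : SimpleGraph V) (x y u : V) : ℝ :=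
  if u = x then 2 else if u = y then 1 else if G.Adj x u then 3 else 0

/-- For duality the Lipschitz bound is needed only from the support of the step at `x` to that of
the step at `y`. The extreme case is 3 - 0, for another neighbour of `x` and another neighbour of
`y`. -/
theorem edgePotential_sub_le (hg : 5 < G.egirth) {x y u v : V} (h : G.Adj x y)
    (hu : u = x ∨ G.Adj x u) (hv : v = y ∨ G.Adj y v) :
    edgePotential G x y u - edgePotential G x y v ≤ G.dist u v := by
  have hru : G.Reachable x u := by
    rcases hu with rfl | hu
    exacts [.refl _, hu.reachable]
  have hrv : G.Reachable y v := by
    rcases hv with rfl | hv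
    exacts [.refl _, hv.reachable]
  have hr : G.Reachable u v := hru.symm.trans (h.reachable.trans hrv)
  have hxy := h.ne
  have hnn : (0 : ℝ) ≤ G.dist u v := Nat.cast_nonneg _
  have one : u ≠ v → (1 : ℝ) ≤ G.dist u v := fun hne => by
    exact_mod_cast hr.pos_dist_of_ne hne
  have two : u ≠ v → ¬ G.Adj u v → (2 : ℝ) ≤ G.dist u v := fun hne ha => by
    exact_mod_cast two_le_dist hr hne ha
  have fv : v ≠ x → v ≠ y → edgePotential G x y v = 0 := fun h1 h2 => by
    have h3 : ¬ G.Adj x v := fun h3 =>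
      not_adj_of_common_neighbor hg h (hv.resolve_left h2) h3.symm
    rw [edgePotential, if_neg h1, if_neg h2, if_neg h3]
  have fx : edgePotential G x y x = 2 := if_pos rfl
  have fy : edgePotential G x y y = 1 := by
    rw [edgePotential, if_neg hxy.symm, if_pos rfl]
  by_cases hux : u = x
  · subst hux
    by_cases hvu : v = u
    · subst hvu; simp
    by_cases hvy : v = y
    · subst hvy; rw [fx, fy]; linarith [one hxy]
    rw [fx, fv hvu hvy]
    have := two (Ne.symm hvu) fun h3 =>
      not_adj_of_common_neighbor hg h (hv.resolve_left hvy) h3.symm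
    linarith
  have hxu := hu.resolve_left hux
  by_cases huy : u = y
  · subst huy
    by_cases hvu : v = u
    · subst hvu; simp
    by_cases hvx : v = x
    · subst hvx; rw [fx, fy]; linarith
    rw [fy, fv hvx hvu]
    linarith [one (Ne.symm hvu)]
  have fu : edgePotential G x y u = 3 := by
    rw [edgePotential, if_neg hux, if_neg huy, if_pos hxu]
  have huy' : ¬ G.Adj u y := fun h3 => not_adj_of_common_neighbor hg hxu h3 h.symm
  rw [fu]
  by_cases hvx : v = x
  · subst hvx
    rw [fx]; linarith [one hux]
  by_cases hvy : v = y
  · subst hvy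
    rw [fy]; linarith [two huy huy']
  have hyv := hv.resolve_left hvy
  rw [fv hvx hvy]
  have huv : u ≠ v := fun he => huy' (he ▸ hyv.symm)
  -- Distances 0, 1 and 2 would close a triangle, a quadrilateral and a pentagon with the edge `x
  -- y`.
  have : 3 ≤ G.dist u v := by
    refine three_le_dist hr huv ?_ ?_
    · exact fun ha => not_exists_four_cycle hg hxu ha hyv.symm (Ne.symm hvx) huy h.symm
    · intro z huz hzv
      have hzx : z ≠ x := fun he => by
        subst he; exact not_adj_of_common_neighbor hg h hyv hzv.symm
      have hzy : z ≠ y := fun he => huy' (he ▸ huz)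
      exact not_exists_five_cycle hg hxu huz hzv hyv.symm hzx.symm (Ne.symm hvx) huv huy hzy h.symm
  have : (3 : ℝ) ≤ G.dist u v := by exact_mod_cast this
  linarith

/-! ### Optimal transport between adjacent lazy steps -/

variable {w : G.edgeSet → ℝ}

theorem edgeWeight_of_adj {x y : V} (h : G.Adj x y) :
    edgeWeight G w x y = w ⟨s(x, y), h⟩ := dif_pos h

theorem edgeWeight_of_not_adj {x y : V} (h : ¬ G.Adj x y) : edgeWeight G w x y = 0 := dif_neg h

theorem edgeWeight_comm (x y : V) : edgeWeight G w x y = edgeWeight G w y x := by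
  unfold edgeWeight
  by_cases h : G.Adj x y
  · rw [dif_pos h, dif_pos h.symm]
    congr 2
    exact Sym2.eq_swap
  · rw [dif_neg h, dif_neg fun h' => h h'.symm]

theorem edgeWeight_nonneg (hw : ∀ e, 0 < w e) (x y : V) : 0 ≤ edgeWeight G w x y := by
  unfold edgeWeight
  split_ifs
  · exact (hw _).le
  · exact le_rfl

variable [Fintype V]

theorem vertexWeight_pos (hw : ∀ e, 0 < w e) {x y : V} (h : G.Adj x y) :
    0 < vertexWeight G w x :=
  Finset.sum_pos' (fun z _ => edgeWeight_nonneg hw x z)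
    ⟨y, Finset.mem_univ _, by rw [edgeWeight_of_adj h]; exact hw _⟩

theorem lazyStep_self (α : ℝ) (x : V) : lazyStep G w α x x = α := if_pos rfl

theorem lazyStep_of_ne {α : ℝ} {x y : V} (h : y ≠ x) :
    lazyStep G w α x y = (1 - α) * (edgeWeight G w x y / vertexWeight G w x) := if_neg h

theorem lazyStep_nonneg (hw : ∀ e, 0 < w e) {α : ℝ} (h0 : 0 ≤ α) (h1 : α ≤ 1) (x y : V) :
    0 ≤ lazyStep G w α x y := by
  unfold lazyStep
  split_ifs
  · exact h0
  · exact mul_nonneg (by linarith) (div_nonneg (edgeWeight_nonneg hw _ _)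
      (Finset.sum_nonneg fun z _ => edgeWeight_nonneg hw x z))

open Classical in
theorem sum_lazyStep_erase (hw : ∀ e, 0 < w e) {α : ℝ} {x y : V} (h : G.Adj x y) :
    ∑ u ∈ Finset.univ.erase x, lazyStep G w α x u = 1 - α := by
  have hpos := vertexWeight_pos hw h
  have h0 : edgeWeight G w x x = 0 := edgeWeight_of_not_adj (G.irrefl)
  calc ∑ u ∈ Finset.univ.erase x, lazyStep G w α x u
      = ∑ u ∈ Finset.univ.erase x, (1 - α) * (edgeWeight G w x u / vertexWeight G w x) :=
        Finset.sum_congr rfl fun u hu => lazyStep_of_ne (Finset.ne_of_mem_erase hu)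
    _ = ∑ u, (1 - α) * (edgeWeight G w x u / vertexWeight G w x) :=
        Finset.sum_erase _ (by rw [h0]; simp)
    _ = (1 - α) * (vertexWeight G w x / vertexWeight G w x) := by
        rw [← Finset.mul_sum, ← Finset.sum_div]; rfl
    _ = 1 - α := by rw [div_self hpos.ne', mul_one]

open Classical in
theorem sum_lazyStep (hw : ∀ e, 0 < w e) {α : ℝ} {x y : V} (h : G.Adj x y) :
    ∑ u, lazyStep G w α x u = 1 := by
  rw [← Finset.add_sum_erase _ _ (Finset.mem_univ x), sum_lazyStep_erase hw h, lazyStep_self]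
  ring

theorem lazyStep_le_one (hw : ∀ e, 0 < w e) {α : ℝ} (h0 : 0 ≤ α) (h1 : α ≤ 1) {x y : V}
    (h : G.Adj x y) (u : V) : lazyStep G w α x u ≤ 1 := by
  rw [← sum_lazyStep (α := α) hw h]
  exact Finset.single_le_sum (fun z _ => lazyStep_nonneg hw h0 h1 x z) (Finset.mem_univ u)

open Classical in
/-- The transport plan that keeps the mass `2α - 1` on the edge `x y` and moves the remaining mass
at `x` to the neighbours of `y` and that at the neighbours of `x` to `y`. -/
noncomputable def edgePlan (G : SimpleGraph V) (w : G.edgeSet → ℝ) (α : ℝ) (x y u v : V) : ℝ :=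
  if u = x then (if v = y then 2 * α - 1 else lazyStep G w α y v)
  else (if v = y then lazyStep G w α x u else 0)

theorem isTransportPlan_edgePlan (hw : ∀ e, 0 < w e) {α : ℝ} (h0 : 1 / 2 ≤ α) (h1 : α ≤ 1)
    {x y : V} (h : G.Adj x y) :
    IsTransportPlan (lazyStep G w α x) (lazyStep G w α y) (edgePlan G w α x y) := by
  classical
  have h0' : 0 ≤ α := by linarith
  refine ⟨fun u v => ?_, fun u => ?_, fun v => ?_⟩
  · unfold edgePlan
    split_ifs
    -- The entry `2 * α - 1` is nonnegative because α ≥ 1/2.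
    · exact ⟨by linarith, by linarith⟩
    · exact ⟨lazyStep_nonneg hw h0' h1 _ _, lazyStep_le_one hw h0' h1 h.symm _⟩
    · exact ⟨lazyStep_nonneg hw h0' h1 _ _, lazyStep_le_one hw h0' h1 h _⟩
    · exact ⟨le_rfl, zero_le_one⟩
  · by_cases hu : u = x
    · subst hu
      rw [← Finset.add_sum_erase _ _ (Finset.mem_univ y), Finset.sum_congr rfl fun v hv =>
        show edgePlan G w α u y u v = lazyStep G w α y v by
          rw [edgePlan, if_pos rfl, if_neg (Finset.ne_of_mem_erase hv)],
        sum_lazyStep_erase hw h.symm, lazyStep_self, edgePlan, if_pos rfl, if_pos rfl]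
      ring
    · simp [edgePlan, hu]
  · by_cases hv : v = y
    · subst hv
      rw [← Finset.add_sum_erase _ _ (Finset.mem_univ x), Finset.sum_congr rfl fun u hu =>
        show edgePlan G w α x v u v = lazyStep G w α x u by
          rw [edgePlan, if_neg (Finset.ne_of_mem_erase hu), if_pos rfl],
        sum_lazyStep_erase hw h, lazyStep_self, edgePlan, if_pos rfl, if_pos rfl]
      ring
    · simp [edgePlan, hv]

/-- A neighbour `v` of `y` that carries mass is at distance at most two from `x`. -/
theorem dist_mul_lazyStep_le (hw : ∀ e, 0 < w e) {α : ℝ} (h0 : 0 ≤ α) (h1 : α ≤ 1) {x y v : V}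
    (h : G.Adj x y) (hv : v ≠ y) :
    (G.dist x v : ℝ) * lazyStep G w α y v ≤ 2 * lazyStep G w α y v := by
  by_cases hyv : G.Adj y v
  · refine mul_le_mul_of_nonneg_right ?_ (lazyStep_nonneg hw h0 h1 _ _)
    exact_mod_cast SimpleGraph.dist_le (.cons h (.cons hyv .nil))
  · rw [lazyStep_of_ne hv, edgeWeight_of_not_adj hyv]
    simp

open Classical in
-- The mass `2 * α - 1` moves by 1. The rest moves by at most 2, except the parts that stay at `x`
-- and at `y`, which account for the two subtracted terms.
theorem cost_edgePlan_le (hw : ∀ e, 0 < w e) {α : ℝ} (h0 : 1 / 2 ≤ α) (h1 : α ≤ 1)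
    {x y : V} (h : G.Adj x y) :
    ∑ u, ∑ v, (G.dist u v : ℝ) * edgePlan G w α x y u v ≤
      α + (1 - α) * (3 - 2 * (edgeWeight G w x y / vertexWeight G w x)
        - 2 * (edgeWeight G w x y / vertexWeight G w y)) := by
  have h0' : 0 ≤ α := by linarith
  have side : ∀ {x y : V}, G.Adj x y →
      ∑ v ∈ Finset.univ.erase y, (G.dist x v : ℝ) * lazyStep G w α y v ≤
        2 * (1 - α) - 2 * ((1 - α) * (edgeWeight G w x y / vertexWeight G w y)) := by
    intro x y h
    have hx : x ∈ Finset.univ.erase y := by simp [h.ne]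
    have hs := sum_lazyStep_erase (α := α) hw h.symm
    rw [← Finset.add_sum_erase _ _ hx] at hs ⊢
    rw [lazyStep_of_ne h.ne, edgeWeight_comm] at hs
    rw [SimpleGraph.dist_self, Nat.cast_zero, zero_mul, zero_add]
    calc _ ≤ ∑ v ∈ (Finset.univ.erase y).erase x, 2 * lazyStep G w α y v :=
          Finset.sum_le_sum fun v hv => dist_mul_lazyStep_le hw h0' h1 h (by
            simp only [Finset.mem_erase] at hv; exact hv.2.1)
      _ = _ := by rw [← Finset.mul_sum]; linarith
  have hrow : ∑ v, (G.dist x v : ℝ) * edgePlan G w α x y x v =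
      (2 * α - 1) + ∑ v ∈ Finset.univ.erase y, (G.dist x v : ℝ) * lazyStep G w α y v := by
    rw [← Finset.add_sum_erase _ _ (Finset.mem_univ y)]
    congr 1
    · rw [SimpleGraph.dist_eq_one_iff_adj.2 h, edgePlan, if_pos rfl, if_pos rfl]; simp
    · exact Finset.sum_congr rfl fun v hv => by
        rw [edgePlan, if_pos rfl, if_neg (Finset.ne_of_mem_erase hv)]
  have hcol : ∀ u ∈ Finset.univ.erase x, ∑ v, (G.dist u v : ℝ) * edgePlan G w α x y u v =
      (G.dist y u : ℝ) * lazyStep G w α x u := by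
    intro u hu
    rw [Finset.sum_eq_single y, edgePlan, if_neg (Finset.ne_of_mem_erase hu), if_pos rfl,
      SimpleGraph.dist_comm]
    · intro v _ hv
      rw [edgePlan, if_neg (Finset.ne_of_mem_erase hu), if_neg hv, mul_zero]
    · simp
  rw [← Finset.add_sum_erase _ _ (Finset.mem_univ x), hrow, Finset.sum_congr rfl hcol]
  have h2 := side h
  have h3 := side h.symm
  rw [edgeWeight_comm y x] at h3
  linarith

/-- The dual value equals the upper bound for the cost of `edgePlan`, so both are optimal. -/
theorem sum_edgePotential_mul_sub (hw : ∀ e, 0 < w e) (hg : 5 < G.egirth) (α : ℝ)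
    {x y : V} (h : G.Adj x y) :
    ∑ u, edgePotential G x y u * lazyStep G w α x u -
        ∑ u, edgePotential G x y u * lazyStep G w α y u =
      α + (1 - α) * (3 - 2 * (edgeWeight G w x y / vertexWeight G w x)
        - 2 * (edgeWeight G w x y / vertexWeight G w y)) := by
  classical
  have hxy := h.ne
  have fx : edgePotential G x y x = 2 := if_pos rfl
  have fy : edgePotential G x y y = 1 := by
    rw [edgePotential, if_neg hxy.symm, if_pos rfl]
  have hyx : y ∈ Finset.univ.erase x := by simp [hxy.symm]
  have hxy' : x ∈ Finset.univ.erase y := by simp [hxy]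
  have hs := sum_lazyStep_erase (α := α) hw h
  rw [← Finset.add_sum_erase _ _ hyx, lazyStep_of_ne hxy.symm] at hs
  have h1 : ∑ u, edgePotential G x y u * lazyStep G w α x u = 2 * α +
      ((1 - α) * (edgeWeight G w x y / vertexWeight G w x) +
        3 * ∑ u ∈ (Finset.univ.erase x).erase y, lazyStep G w α x u) := by
    rw [← Finset.add_sum_erase _ _ (Finset.mem_univ x), ← Finset.add_sum_erase _ _ hyx, fx, fy,
      lazyStep_self, lazyStep_of_ne hxy.symm, one_mul, Finset.mul_sum]
    congr 2
    refine Finset.sum_congr rfl fun u hu => ?_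
    simp only [Finset.mem_erase] at hu
    by_cases ha : G.Adj x u
    · rw [edgePotential, if_neg hu.2.1, if_neg hu.1, if_pos ha]
    · rw [lazyStep_of_ne hu.2.1, edgeWeight_of_not_adj ha]; simp
  have h2 : ∑ u, edgePotential G x y u * lazyStep G w α y u = α +
      2 * ((1 - α) * (edgeWeight G w x y / vertexWeight G w y)) := by
    rw [← Finset.add_sum_erase _ _ (Finset.mem_univ y), ← Finset.add_sum_erase _ _ hxy', fx, fy,
      lazyStep_self, lazyStep_of_ne hxy, one_mul, Finset.sum_eq_zero, add_zero,
      edgeWeight_comm y x]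
    intro u hu
    simp only [Finset.mem_erase] at hu
    by_cases ha : G.Adj y u
    · have hxu : ¬ G.Adj x u := fun h3 => not_adj_of_common_neighbor hg h ha h3.symm
      rw [edgePotential, if_neg hu.1, if_neg hu.2.1, if_neg hxu, zero_mul]
    · rw [lazyStep_of_ne hu.2.1, edgeWeight_of_not_adj ha]; simp
  rw [h1, h2]
  linarith

theorem IsTransportPlan.eq_zero_of_left {μ ν : V → ℝ} {A : V → V → ℝ} (hA : IsTransportPlan μ ν A)
    {u : V} (hu : μ u = 0) (v : V) : A u v = 0 :=
  (Finset.sum_eq_zero_iff_of_nonneg fun v _ => (hA.mem_Icc u v).1).1 ((hA.left u).trans hu) v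
    (Finset.mem_univ v)

theorem IsTransportPlan.eq_zero_of_right {μ ν : V → ℝ} {A : V → V → ℝ}
    (hA : IsTransportPlan μ ν A) {v : V} (hv : ν v = 0) (u : V) : A u v = 0 :=
  (Finset.sum_eq_zero_iff_of_nonneg fun u _ => (hA.mem_Icc u v).1).1 ((hA.right v).trans hv) u
    (Finset.mem_univ u)

/-- Weak Kantorovich duality. A plan puts no mass outside the product of the supports, so `f` is
constrained only there. -/
theorem IsTransportPlan.sum_sub_le_cost {μ ν : V → ℝ} {A : V → V → ℝ}
    (hA : IsTransportPlan μ ν A) (f : V → ℝ)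
    (hf : ∀ u v, μ u ≠ 0 → ν v ≠ 0 → f u - f v ≤ G.dist u v) :
    ∑ u, f u * μ u - ∑ v, f v * ν v ≤ ∑ u, ∑ v, (G.dist u v : ℝ) * A u v := by
  have h1 : ∑ u, f u * μ u = ∑ u, ∑ v, f u * A u v :=
    Finset.sum_congr rfl fun u _ => by rw [← hA.left u, Finset.mul_sum]
  have h2 : ∑ v, f v * ν v = ∑ u, ∑ v, f v * A u v := by
    rw [Finset.sum_comm]
    exact Finset.sum_congr rfl fun v _ => by rw [← hA.right v, Finset.mul_sum]
  rw [h1, h2, ← Finset.sum_sub_distrib]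
  refine Finset.sum_le_sum fun u _ => ?_
  rw [← Finset.sum_sub_distrib]
  refine Finset.sum_le_sum fun v _ => ?_
  rw [← sub_mul]
  by_cases hu : μ u = 0
  · rw [hA.eq_zero_of_left hu]; simp
  by_cases hv : ν v = 0
  · rw [hA.eq_zero_of_right hv]; simp
  exact mul_le_mul_of_nonneg_right (hf u v hu hv) (hA.mem_Icc u v).1

theorem eq_or_adj_of_lazyStep_ne_zero {α : ℝ} {x u : V} (h : lazyStep G w α x u ≠ 0) :
    u = x ∨ G.Adj x u := by
  by_contra! hc
  rw [lazyStep_of_ne hc.1, edgeWeight_of_not_adj hc.2] at h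
  simp at h

theorem wasserstein_lazyStep (hw : ∀ e, 0 < w e) (hg : 5 < G.egirth) {α : ℝ} (h0 : 1 / 2 ≤ α)
    (h1 : α ≤ 1) {x y : V} (h : G.Adj x y) :
    wasserstein G (lazyStep G w α x) (lazyStep G w α y) =
      α + (1 - α) * (3 - 2 * (edgeWeight G w x y / vertexWeight G w x)
        - 2 * (edgeWeight G w x y / vertexWeight G w y)) := by
  have hlow : ∀ A, IsTransportPlan (lazyStep G w α x) (lazyStep G w α y) A →
      α + (1 - α) * (3 - 2 * (edgeWeight G w x y / vertexWeight G w x)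
        - 2 * (edgeWeight G w x y / vertexWeight G w y)) ≤
        ∑ u, ∑ v, (G.dist u v : ℝ) * A u v := by
    intro A hA
    rw [← sum_edgePotential_mul_sub hw hg α h]
    exact hA.sum_sub_le_cost _ fun u v hu hv => edgePotential_sub_le hg h
      (eq_or_adj_of_lazyStep_ne_zero hu) (eq_or_adj_of_lazyStep_ne_zero hv)
  have hplan := isTransportPlan_edgePlan hw h0 h1 h
  unfold wasserstein
  refine le_antisymm (csInf_le_of_le ?_ ⟨_, hplan, rfl⟩ (cost_edgePlan_le hw h0 h1 h))
    (le_csInf ⟨_, _, hplan, rfl⟩ ?_)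
  · exact ⟨_, fun c ⟨A, hA, hc⟩ => (hlow A hA).trans_eq hc.symm⟩
  · rintro _ ⟨A, hA, rfl⟩
    exact hlow A hA

/-- The Lin-Lu-Yau curvature of an edge of a weighted graph of girth greater than five. -/
theorem hasLLYCurvature_of_egirth (hw : ∀ e, 0 < w e) (hg : 5 < G.egirth) {x y : V}
    (h : G.Adj x y) :
    HasLLYCurvature G w x y (2 * (edgeWeight G w x y / vertexWeight G w x +
      edgeWeight G w x y / vertexWeight G w y) - 2) := by
  -- The Wasserstein distance is affine in α on [1/2, 1], with value 1 at α = 1, so the quotient is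
  -- constant near 1.
  refine tendsto_const_nhds.congr' ?_
  have hmem : Ioo (1 / 2 : ℝ) 1 ∈ 𝓝[<] (1 : ℝ) := Ioo_mem_nhdsLT (by norm_num)
  filter_upwards [hmem] with α hα
  rw [wasserstein_lazyStep hw hg hα.1.le hα.2.le h, SimpleGraph.dist_eq_one_iff_adj.2 h]
  have : 1 - α ≠ 0 := by linarith [hα.2]
  field_simp
  ring

end Curvature

/-! ### Global solutions of autonomous equations with a bounded field -/

section GlobalFlow

variable {E : Type*} [NormedAddCommGroup E] [NormedSpace ℝ E] [ProperSpace E] {F : E → E}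

theorem ContDiff.exists_lipschitzOnWith_closedBall (hF : ContDiff ℝ 1 F) (x : E) (r : ℝ) :
    ∃ K, LipschitzOnWith K F (Metric.closedBall x r) :=
  hF.contDiffOn.exists_lipschitzOnWith one_ne_zero (convex_closedBall x r)
    (isCompact_closedBall x r)

/-- A bounded `C¹` field has integral curves on arbitrarily large intervals. -/
theorem exists_integralCurve_Icc (hF : ContDiff ℝ 1 F) {L : ℝ} (hL : ∀ x, ‖F x‖ ≤ L) (x₀ : E)
    {T : ℝ} (hT : 0 ≤ T) :
    ∃ u : ℝ → E, u 0 = x₀ ∧ ∀ t ∈ Icc (-T) T, HasDerivWithinAt u (F (u t)) (Icc (-T) T) t := by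
  have hL0 : 0 ≤ L := (norm_nonneg _).trans (hL x₀)
  obtain ⟨K, hK⟩ := hF.exists_lipschitzOnWith_closedBall x₀ (L * T)
  -- A field bounded by `L` cannot leave the ball of radius `L * T` within time `T`, so a Lipschitz
  -- constant on that ball suffices.
  have hPL : IsPicardLindelof (fun _ => F) (tmin := -T) (tmax := T)
      ⟨0, by constructor <;> linarith⟩ x₀ ⟨L * T, by positivity⟩ 0 ⟨L, hL0⟩ K :=
    { lipschitzOnWith := fun _ _ => hK
      continuousOn := fun _ _ => continuousOn_const
      norm_le := fun _ _ x _ => hL x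
      mul_max_le := by
        change L * max (T - 0) (0 - -T) ≤ L * T - 0
        simp }
  exact hPL.exists_eq_forall_mem_Icc_hasDerivWithinAt₀

/-- Both curves are bounded on the compact interval, so they stay in a ball on which the field is
Lipschitz. -/
theorem integralCurve_eqOn_Icc (hF : ContDiff ℝ 1 F) {T : ℝ} (hT : 0 < T) {f g : ℝ → E}
    (hf : ContinuousOn f (Icc (-T) T)) (hf' : ∀ t ∈ Ioo (-T) T, HasDerivAt f (F (f t)) t)
    (hg : ContinuousOn g (Icc (-T) T)) (hg' : ∀ t ∈ Ioo (-T) T, HasDerivAt g (F (g t)) t)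
    (h0 : f 0 = g 0) : EqOn f g (Icc (-T) T) := by
  obtain ⟨R, hR⟩ := isCompact_Icc.exists_bound_of_continuousOn hf
  obtain ⟨R', hR'⟩ := isCompact_Icc.exists_bound_of_continuousOn hg
  obtain ⟨K, hK⟩ := hF.exists_lipschitzOnWith_closedBall 0 (max R R')
  refine ODE_solution_unique_of_mem_Icc (v := fun _ => F) (s := fun _ => Metric.closedBall 0
    (max R R')) (t₀ := 0) (fun _ _ => hK) ⟨by linarith, hT⟩ hf hf' (fun t ht => ?_) hg hg'
    (fun t ht => ?_) h0
  · rw [mem_closedBall_zero_iff]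
    exact (hR t (Ioo_subset_Icc_self ht)).trans (le_max_left _ _)
  · rw [mem_closedBall_zero_iff]
    exact (hR' t (Ioo_subset_Icc_self ht)).trans (le_max_right _ _)

/-- A bounded `C¹` field has global integral curves. -/
theorem exists_integralCurve (hF : ContDiff ℝ 1 F) {L : ℝ} (hL : ∀ x, ‖F x‖ ≤ L) (x₀ : E) :
    ∃ u : ℝ → E, u 0 = x₀ ∧ ∀ t, HasDerivAt u (F (u t)) t := by
  have hT : ∀ n : ℕ, (0 : ℝ) < n + 1 := fun n => by positivity
  choose α hα0 hα using fun n : ℕ => exists_integralCurve_Icc hF hL x₀ (hT n).le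
  have hcont : ∀ n : ℕ, ContinuousOn (α n) (Icc (-(n + 1 : ℝ)) (n + 1)) := fun n t ht =>
    (hα n t ht).continuousWithinAt
  have hder : ∀ n : ℕ, ∀ t ∈ Ioo (-(n + 1 : ℝ)) (n + 1), HasDerivAt (α n) (F (α n t)) t :=
    fun n t ht => (hα n t (Ioo_subset_Icc_self ht)).hasDerivAt (Icc_mem_nhds ht.1 ht.2)
  have hagree : ∀ n m : ℕ, n ≤ m → EqOn (α n) (α m) (Icc (-(n + 1 : ℝ)) (n + 1)) := by
    intro n m hnm
    have hnm' : (n : ℝ) ≤ m := Nat.cast_le.2 hnm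
    refine integralCurve_eqOn_Icc hF (hT n) (hcont n) (hder n) ((hcont m).mono ?_)
      (fun t ht => hder m t ?_) ((hα0 n).trans (hα0 m).symm)
    · exact Icc_subset_Icc (by linarith) (by linarith)
    · exact Ioo_subset_Ioo (by linarith) (by linarith) ht
  -- The `n`-th curve lives on [-(n+1), n+1]. The extra unit keeps points with |s| ≤ n in the
  -- interior, where two-sided derivatives exist.
  have hu : ∀ (n : ℕ) (s : ℝ), |s| ≤ n → α ⌈|s|⌉₊ s = α n s := by
    intro n s hs
    refine hagree _ _ (Nat.ceil_le.2 hs) ?_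
    have := Nat.le_ceil |s|
    exact abs_le.1 (by linarith)
  refine ⟨fun t => α ⌈|t|⌉₊ t, by simpa using hα0 0, fun t => ?_⟩
  obtain ⟨n, hn⟩ := exists_nat_gt |t|
  have hev : (fun t => α ⌈|t|⌉₊ t) =ᶠ[𝓝 t] α n := by
    filter_upwards [(continuous_abs.tendsto t).eventually_lt_const hn] with s hs
    exact hu n s hs.le
  have h1 := abs_lt.1 hn
  have := hder n t ⟨by linarith, by linarith⟩
  rw [← hu n t hn.le] at this
  exact this.congr_of_eventuallyEq hev

/-- Forward integral curves that are only assumed to be continuous at the initial time are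
unique. -/
theorem integralCurve_unique (hF : ContDiff ℝ 1 F) {f g : ℝ → E}
    (hf : ContinuousOn f (Ici 0)) (hf' : ∀ t, 0 < t → HasDerivAt f (F (f t)) t)
    (hg : ContinuousOn g (Ici 0)) (hg' : ∀ t, 0 < t → HasDerivAt g (F (g t)) t)
    (h0 : f 0 = g 0) {t : ℝ} (ht : 0 ≤ t) : f t = g t := by
  -- Continuity at 0 gives the derivative a limit there, which is then the right derivative.
  have key : ∀ f : ℝ → E, ContinuousOn f (Ici 0) → (∀ t, 0 < t → HasDerivAt f (F (f t)) t) →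
      ∀ s, 0 ≤ s → HasDerivWithinAt f (F (f s)) (Ici s) s := by
    intro f hf hf' s hs
    rcases hs.eq_or_lt with rfl | hs
    · refine hasDerivWithinAt_Ici_of_tendsto_deriv (s := Ioi 0)
        (fun s hs => (hf' s hs).differentiableAt.differentiableWithinAt)
        ((hf 0 self_mem_Ici).mono Ioi_subset_Ici_self) self_mem_nhdsWithin ?_
      have h1 : Tendsto (fun s => F (f s)) (𝓝[>] 0) (𝓝 (F (f 0))) :=
        (hF.continuous.tendsto _).comp ((hf 0 self_mem_Ici).mono Ioi_subset_Ici_self)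
      refine h1.congr' ?_
      filter_upwards [self_mem_nhdsWithin] with s hs
      exact (hf' s hs).deriv.symm
    · exact (hf' s hs).hasDerivWithinAt
  obtain ⟨R, hR⟩ := isCompact_Icc.exists_bound_of_continuousOn
    (hf.mono (Icc_subset_Ici_self : Icc 0 t ⊆ Ici 0))
  obtain ⟨R', hR'⟩ := isCompact_Icc.exists_bound_of_continuousOn
    (hg.mono (Icc_subset_Ici_self : Icc 0 t ⊆ Ici 0))
  obtain ⟨K, hK⟩ := hF.exists_lipschitzOnWith_closedBall 0 (max R R')
  refine ODE_solution_unique_of_mem_Icc_right (v := fun _ => F) (s := fun _ => Metric.closedBall 0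
    (max R R')) (K := K) (fun _ _ => hK) (hf.mono Icc_subset_Ici_self)
    (fun s hs => key f hf hf' s hs.1) (fun s hs => ?_)
    (hg.mono Icc_subset_Ici_self) (fun s hs => key g hg hg' s hs.1) (fun s hs => ?_) h0
    (right_mem_Icc.2 ht)
  · rw [mem_closedBall_zero_iff]
    exact (hR s (Ico_subset_Icc_self hs)).trans (le_max_left _ _)
  · rw [mem_closedBall_zero_iff]
    exact (hR' s (Ico_subset_Icc_self hs)).trans (le_max_right _ _)

end GlobalFlow

/-! ### The normalized flow in logarithmic coordinates -/

section LogFlow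

variable {V E : Type*}

/-- On [k, ∞) the slope of exp is at least exp k. -/
theorem mul_sub_exp_sub_exp_ge {a b k : ℝ} (ha : k ≤ a) (hb : k ≤ b) :
    Real.exp k * (a - b) ^ 2 ≤ (a - b) * (Real.exp a - Real.exp b) := by
  wlog hab : b ≤ a generalizing a b
  · have := this hb ha (le_of_not_ge hab)
    linarith [show (a - b) ^ 2 = (b - a) ^ 2 by ring]
  have h1 : Real.exp a = Real.exp b * Real.exp (a - b) := by rw [← Real.exp_add]; ring_nf
  have h2 := Real.add_one_le_exp (a - b)
  have h3 : Real.exp k ≤ Real.exp b := Real.exp_le_exp.2 hb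
  have h4 : Real.exp b * (a - b) ≤ Real.exp a - Real.exp b := by
    have : Real.exp b * (a - b) + Real.exp b ≤ Real.exp b * Real.exp (a - b) := by
      have := mul_le_mul_of_nonneg_left h2 (Real.exp_pos b).le
      linarith
    linarith
  calc Real.exp k * (a - b) ^ 2 ≤ Real.exp b * (a - b) ^ 2 := by gcongr
    _ = (a - b) * (Real.exp b * (a - b)) := by ring
    _ ≤ _ := mul_le_mul_of_nonneg_left h4 (by linarith)

theorem sum_sum_sub_mul_sub (s : Finset E) (u w : E → ℝ) :
    ∑ e ∈ s, ∑ f ∈ s, (u e - u f) * (w e - w f) =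
      2 * (s.card * ∑ e ∈ s, u e * w e - (∑ e ∈ s, u e) * ∑ e ∈ s, w e) := by
  have : ∀ e f, (u e - u f) * (w e - w f) = u e * w e + u f * w f - u e * w f - w e * u f := by
    intro e f; ring
  simp only [this, Finset.sum_add_distrib, Finset.sum_sub_distrib, Finset.sum_const,
    nsmul_eq_mul, ← Finset.mul_sum, ← Finset.sum_mul]
  ring

/-- The left factor is a lower bound for the coercivity of the softmax at one vertex; it depends on
the oscillation `R` and not on the level `k`, since softmax ignores additive constants. -/
theorem sum_mul_softmax_sub_ge (s : Finset E) {u : E → ℝ} {k R : ℝ} (hu : ∀ e, |u e - k| ≤ R)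
    {N : ℝ} (hN : s.card ≤ N) :
    Real.exp (-(2 * R)) / (2 * N ^ 2) * ∑ e ∈ s, ∑ f ∈ s, (u e - u f) ^ 2 ≤
      ∑ e ∈ s, u e * (Real.exp (u e) / ∑ f ∈ s, Real.exp (u f) - 1 / s.card) := by
  rcases s.eq_empty_or_nonempty with rfl | hs
  · simp
  have hd : (0 : ℝ) < s.card := by exact_mod_cast hs.card_pos
  have hN0 : 0 < N := hd.trans_le hN
  set Z := ∑ f ∈ s, Real.exp (u f) with hZ
  have hZ0 : 0 < Z := Finset.sum_pos (fun f _ => Real.exp_pos _) hs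
  have hZle : Z ≤ s.card * Real.exp (k + R) := by
    rw [← nsmul_eq_mul]
    exact Finset.sum_le_card_nsmul _ _ _ fun f _ =>
      Real.exp_le_exp.2 (by linarith [(abs_le.1 (hu f)).2])
  -- The sum is a covariance of `u` and exp u over `s`; symmetrizing exhibits it as a double sum of
  -- nonnegative terms.
  have hEq : ∑ e ∈ s, u e * (Real.exp (u e) / Z - 1 / s.card) =
      (∑ e ∈ s, ∑ f ∈ s, (u e - u f) * (Real.exp (u e) - Real.exp (u f))) /
        (2 * (s.card * Z)) := by
    rw [sum_sum_sub_mul_sub, ← hZ]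
    have h1 : ∑ e ∈ s, u e * (Real.exp (u e) / Z - 1 / s.card) =
        (∑ e ∈ s, u e * Real.exp (u e)) / Z - (∑ e ∈ s, u e) / s.card := by
      rw [Finset.sum_div, Finset.sum_div, ← Finset.sum_sub_distrib]
      exact Finset.sum_congr rfl fun e _ => by ring
    rw [h1]
    field_simp
  rw [hEq, le_div_iff₀ (by positivity)]
  have hge : Real.exp (k - R) * ∑ e ∈ s, ∑ f ∈ s, (u e - u f) ^ 2 ≤
      ∑ e ∈ s, ∑ f ∈ s, (u e - u f) * (Real.exp (u e) - Real.exp (u f)) := by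
    rw [Finset.mul_sum]
    refine Finset.sum_le_sum fun e _ => ?_
    rw [Finset.mul_sum]
    exact Finset.sum_le_sum fun f _ => mul_sub_exp_sub_exp_ge
      (by linarith [(abs_le.1 (hu e)).1]) (by linarith [(abs_le.1 (hu f)).1])
  refine le_trans ?_ hge
  have hQ : 0 ≤ ∑ e ∈ s, ∑ f ∈ s, (u e - u f) ^ 2 :=
    Finset.sum_nonneg fun e _ => Finset.sum_nonneg fun f _ => sq_nonneg _
  -- The slope is at least exp (k - R) and the normalization `Z` at most N exp (k + R), so exp k
  -- cancels.
  have hcoef : Real.exp (-(2 * R)) / (2 * N ^ 2) * (2 * (s.card * Z)) ≤ Real.exp (k - R) := by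
    have h1 : (2 * (s.card * Z)) ≤ 2 * N ^ 2 * Real.exp (k + R) := by
      have : s.card * Z ≤ s.card * (s.card * Real.exp (k + R)) := by gcongr
      have h2 : (s.card : ℝ) * (s.card * Real.exp (k + R)) ≤ N * (N * Real.exp (k + R)) := by
        gcongr
      linarith [show N * (N * Real.exp (k + R)) = N ^ 2 * Real.exp (k + R) by ring]
    calc _ ≤ Real.exp (-(2 * R)) / (2 * N ^ 2) * (2 * N ^ 2 * Real.exp (k + R)) := by gcongr
      _ = Real.exp (-(2 * R)) * Real.exp (k + R) := by field_simp
      _ = _ := by rw [← Real.exp_add]; ring_nf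
  calc _ = Real.exp (-(2 * R)) / (2 * N ^ 2) * (2 * (s.card * Z)) *
        ∑ e ∈ s, ∑ f ∈ s, (u e - u f) ^ 2 := by ring
    _ ≤ _ := mul_le_mul_of_nonneg_right hcoef hQ

variable {S : V → Finset E}

theorem sum_exp_pos {x : V} {e : E} (h : e ∈ S x) (u : E → ℝ) :
    0 < ∑ f ∈ S x, Real.exp (u f) :=
  Finset.sum_pos (fun _ _ => Real.exp_pos _) ⟨e, h⟩

variable [Fintype V]

variable (S) in
/-- The energy `∑_x ∑_{e, f ∈ S x} (v_e - v_f)²`. -/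
def starEnergy (v : E → ℝ) : ℝ := ∑ x, ∑ e ∈ S x, ∑ f ∈ S x, (v e - v f) ^ 2

theorem starEnergy_nonneg (v : E → ℝ) : 0 ≤ starEnergy S v :=
  Finset.sum_nonneg fun _ _ => Finset.sum_nonneg fun _ _ => Finset.sum_nonneg fun _ _ => sq_nonneg _

variable [Fintype E]

variable (S) in
open Classical in
/-- The field `u ↦ 2 ∑_{x, e ∈ S x} (1 / |S x| - exp u_e / ∑_{f ∈ S x} exp u_f)`. -/
noncomputable def logFlowField (u : E → ℝ) (e : E) : ℝ :=
  2 * ∑ x, if e ∈ S x then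
    1 / ((S x).card : ℝ) - Real.exp (u e) / ∑ f ∈ S x, Real.exp (u f) else 0

theorem contDiff_logFlowField : ContDiff ℝ 1 (logFlowField S) := by
  refine contDiff_pi.2 fun e => contDiff_const.mul (ContDiff.sum fun x _ => ?_)
  by_cases h : e ∈ S x
  · simp only [if_pos h]
    have hexp : ∀ f : E, ContDiff ℝ 1 fun u : E → ℝ => Real.exp (u f) := fun f =>
      (contDiff_apply ℝ ℝ f).exp
    exact contDiff_const.sub ((hexp e).div (ContDiff.sum fun f _ => hexp f)
      fun u => (sum_exp_pos h u).ne')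
  · simp only [if_neg h]
    exact contDiff_const

theorem norm_logFlowField_le (u : E → ℝ) : ‖logFlowField S u‖ ≤ 2 * Fintype.card V := by
  refine (pi_norm_le_iff_of_nonneg (by positivity)).2 fun e => ?_
  rw [logFlowField, norm_mul, Real.norm_two]
  refine mul_le_mul_of_nonneg_left ((norm_sum_le _ _).trans ?_) two_pos.le
  calc _ ≤ ∑ _x : V, (1 : ℝ) := Finset.sum_le_sum fun x _ => ?_
    _ = _ := by simp
  split_ifs with h
  · have hd : (1 : ℝ) ≤ (S x).card := by exact_mod_cast Finset.card_pos.2 ⟨e, h⟩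
    have h1 : 1 / ((S x).card : ℝ) ≤ 1 := by
      rw [div_le_one (by linarith)]; exact hd
    have h2 : Real.exp (u e) / ∑ f ∈ S x, Real.exp (u f) ≤ 1 := by
      rw [div_le_one (sum_exp_pos h u)]
      exact Finset.single_le_sum (f := fun f => Real.exp (u f))
        (fun f _ => (Real.exp_pos _).le) h
    have h3 : 0 ≤ 1 / ((S x).card : ℝ) := by positivity
    have h4 : 0 ≤ Real.exp (u e) / ∑ f ∈ S x, Real.exp (u f) :=
      div_nonneg (Real.exp_pos _).le (sum_exp_pos h u).le
    rw [Real.norm_eq_abs, abs_le]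
    constructor <;> linarith
  · simp

theorem sum_mul_logFlowField (g u : E → ℝ) : ∑ e, g e * logFlowField S u e =
    -(2 * ∑ x, ∑ e ∈ S x,
      g e * (Real.exp (u e) / ∑ f ∈ S x, Real.exp (u f) - 1 / (S x).card)) := by
  classical
  have h1 : ∀ e, g e * logFlowField S u e = ∑ x, if e ∈ S x then
      2 * (g e * (1 / ((S x).card : ℝ) - Real.exp (u e) / ∑ f ∈ S x, Real.exp (u f))) else 0 := by
    intro e
    rw [logFlowField, ← mul_assoc, Finset.mul_sum]
    refine Finset.sum_congr rfl fun x _ => ?_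
    split_ifs <;> ring
  rw [Finset.sum_congr rfl fun e _ => h1 e, Finset.sum_comm, Finset.mul_sum,
    ← Finset.sum_neg_distrib]
  refine Finset.sum_congr rfl fun x _ => ?_
  rw [← Finset.sum_filter, Finset.filter_mem_eq_inter, Finset.univ_inter, Finset.mul_sum,
    ← Finset.sum_neg_distrib]
  exact Finset.sum_congr rfl fun e _ => by ring

/-- At each vertex with edges, the softmax and the uniform weights both have total mass 1. -/
theorem sum_logFlowField (u : E → ℝ) : ∑ e, logFlowField S u e = 0 := by
  have := sum_mul_logFlowField (S := S) 1 u
  simp only [Pi.one_apply, one_mul] at this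
  rw [this, neg_eq_zero, mul_eq_zero]
  refine Or.inr (Finset.sum_eq_zero fun x _ => ?_)
  rcases (S x).eq_empty_or_nonempty with h | ⟨e, he⟩
  · simp [h]
  have hd : ((S x).card : ℝ) ≠ 0 := by exact_mod_cast (Finset.card_pos.2 ⟨e, he⟩).ne'
  rw [Finset.sum_sub_distrib, ← Finset.sum_div, div_self (sum_exp_pos he u).ne', Finset.sum_const,
    nsmul_eq_mul]
  field_simp
  ring

theorem sum_mul_logFlowField_le {u : E → ℝ} {k R : ℝ} (hu : ∀ e, |u e - k| ≤ R) :
    ∑ e, u e * logFlowField S u e ≤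
      -(Real.exp (-(2 * R)) / (Fintype.card E : ℝ) ^ 2 * starEnergy S u) := by
  rw [sum_mul_logFlowField, neg_le_neg_iff, starEnergy, Finset.mul_sum, Finset.mul_sum]
  refine Finset.sum_le_sum fun x _ => ?_
  have := sum_mul_softmax_sub_ge (S x) hu (N := Fintype.card E)
    (by exact_mod_cast Finset.card_le_univ (S x))
  calc _ = 2 * (Real.exp (-(2 * R)) / (2 * (Fintype.card E : ℝ) ^ 2) *
        ∑ e ∈ S x, ∑ f ∈ S x, (u e - u f) ^ 2) := by
        rw [div_mul_eq_mul_div, div_mul_eq_mul_div, mul_div_assoc', mul_div_mul_left _ _ two_ne_zero]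
    _ ≤ _ := by gcongr

/-- A Poincaré inequality. -/
theorem exists_sum_sq_le_starEnergy
    (hconn : ∀ e f : E, Relation.ReflTransGen (fun e f => ∃ x, e ∈ S x ∧ f ∈ S x) e f) :
    ∃ K : ℝ, 0 < K ∧ ∀ (v : E → ℝ) (k : ℝ), ∑ e, v e = Fintype.card E * k →
      ∑ e, (v e - k) ^ 2 ≤ K * starEnergy S v := by
  have h1 : ∀ e f, ∃ K : ℝ, 0 ≤ K ∧ ∀ v, |v e - v f| ≤ K * √(starEnergy S v) := by
    intro e f
    induction hconn e f with
    | refl => exact ⟨0, le_rfl, by simp⟩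
    | @tail f g _ hfg ih =>
      obtain ⟨K, hK0, hK⟩ := ih
      obtain ⟨x, hf, hg⟩ := hfg
      refine ⟨K + 1, by linarith, fun v => (abs_sub_le _ (v f) _).trans ?_⟩
      rw [add_mul, one_mul]
      refine add_le_add (hK v) (Real.abs_le_sqrt ?_)
      calc (v f - v g) ^ 2 ≤ ∑ g ∈ S x, (v f - v g) ^ 2 :=
            Finset.single_le_sum (f := fun g => (v f - v g) ^ 2) (fun _ _ => sq_nonneg _) hg
        _ ≤ ∑ e ∈ S x, ∑ g ∈ S x, (v e - v g) ^ 2 :=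
            Finset.single_le_sum (f := fun f => ∑ g ∈ S x, (v f - v g) ^ 2)
              (fun _ _ => Finset.sum_nonneg fun _ _ => sq_nonneg _) hf
        _ ≤ _ := Finset.single_le_sum
            (f := fun x => ∑ e ∈ S x, ∑ g ∈ S x, (v e - v g) ^ 2)
            (fun _ _ => Finset.sum_nonneg fun _ _ => Finset.sum_nonneg fun _ _ => sq_nonneg _)
            (Finset.mem_univ x)
  choose K hK0 hK using h1
  -- The sum of all the constants serves as a common bound for all pairs.
  set M := ∑ e, ∑ f, K e f with hM
  have hM0 : 0 ≤ M := Finset.sum_nonneg fun e _ => Finset.sum_nonneg fun f _ => hK0 e f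
  have hKM : ∀ e f v, |v e - v f| ≤ M * √(starEnergy S v) := by
    intro e f v
    refine (hK e f v).trans (mul_le_mul_of_nonneg_right ?_ (Real.sqrt_nonneg _))
    exact (Finset.single_le_sum (f := fun f => K e f) (fun f _ => hK0 e f)
      (Finset.mem_univ f)).trans (Finset.single_le_sum (f := fun e => ∑ f, K e f)
        (fun e _ => Finset.sum_nonneg fun f _ => hK0 e f) (Finset.mem_univ e))
  refine ⟨Fintype.card E * M ^ 2 + 1, by positivity, fun v k hv => ?_⟩
  have hE := starEnergy_nonneg (S := S) v
  have hsum : ∑ e, v e = ∑ _e : E, k := by simp [hv]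
  have hle : ∀ e, (v e - k) ^ 2 ≤ M ^ 2 * starEnergy S v := by
    intro e
    -- Since `k` is the mean, some value of `v` is at most `k` and some is at least `k`.
    obtain ⟨f, -, hf⟩ := Finset.exists_le_of_sum_le ⟨e, Finset.mem_univ e⟩ hsum.le
    obtain ⟨g, -, hg⟩ := Finset.exists_le_of_sum_le ⟨e, Finset.mem_univ e⟩ hsum.ge
    have h2 := (abs_le.1 (hKM e f v)).2
    have h3 := (abs_le.1 (hKM e g v)).1
    rw [← Real.sq_sqrt hE, ← mul_pow]
    exact sq_le_sq' (by linarith) (by linarith)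
  calc ∑ e, (v e - k) ^ 2 ≤ ∑ _e : E, M ^ 2 * starEnergy S v := Finset.sum_le_sum fun e _ => hle e
    _ = Fintype.card E * M ^ 2 * starEnergy S v := by simp; ring
    _ ≤ _ := by nlinarith

/-- The integral curves of the normalized flow in logarithmic coordinates converge exponentially
fast to the constant function with the same mean. -/
theorem exists_abs_sub_le_exp_of_logFlow [Nonempty E]
    (hconn : ∀ e f : E, Relation.ReflTransGen (fun e f => ∃ x, e ∈ S x ∧ f ∈ S x) e f)
    {u : ℝ → E → ℝ} (hu : ∀ t, HasDerivAt u (logFlowField S (u t)) t) :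
    ∃ k C lam : ℝ, 0 ≤ C ∧ 0 < lam ∧ ∀ t, 0 ≤ t → ∀ e, |u t e - k| ≤ C * Real.exp (-lam * t) := by
  have hN : (0 : ℝ) < Fintype.card E := by exact_mod_cast Fintype.card_pos
  have hue : ∀ t e, HasDerivAt (fun s => u s e) (logFlowField S (u t) e) t := fun t e =>
    hasDerivAt_pi.1 (hu t) e
  set k := (∑ e, u 0 e) / Fintype.card E with hk
  have hsum : ∀ t, ∑ e, u t e = Fintype.card E * k := by
    intro t
    have hd : ∀ s, HasDerivAt (fun s => ∑ e, u s e) 0 s := by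
      intro s
      have := HasDerivAt.fun_sum fun e (_ : e ∈ Finset.univ) => hue s e
      rwa [sum_logFlowField] at this
    rw [is_const_of_deriv_eq_zero (fun s => (hd s).differentiableAt) (fun s => (hd s).deriv) t 0,
      hk, mul_div_cancel₀ _ hN.ne']
  set Lf : ℝ → ℝ := fun t => ∑ e, (u t e - k) ^ 2 with hLf
  have hLd : ∀ t, HasDerivAt Lf (2 * ∑ e, u t e * logFlowField S (u t) e) t := by
    intro t
    have h1 := HasDerivAt.fun_sum fun e (_ : e ∈ Finset.univ) => ((hue t e).sub_const k).fun_pow 2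
    refine h1.congr_deriv ?_
    have h2 : ∑ e, k * logFlowField S (u t) e = 0 := by
      rw [← Finset.mul_sum, sum_logFlowField, mul_zero]
    rw [← sub_zero (∑ e, u t e * logFlowField S (u t) e), ← h2, ← Finset.sum_sub_distrib,
      Finset.mul_sum]
    refine Eq.symm ?_
    exact Finset.sum_congr rfl fun e _ => by push_cast; ring
  have habs : ∀ t e, |u t e - k| ≤ √(Lf t) := fun t e => Real.abs_le_sqrt
    (Finset.single_le_sum (f := fun e => (u t e - k) ^ 2) (fun _ _ => sq_nonneg _)
      (Finset.mem_univ e))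
  -- Only the sign of the dissipation is used here, so the oscillation bound may depend on `t`.
  have hanti : Antitone Lf := antitone_of_hasDerivAt_nonpos hLd fun t => by
    have h1 := sum_mul_logFlowField_le (S := S) (habs t)
    have h2 := starEnergy_nonneg (S := S) (u t)
    have : 0 ≤ Real.exp (-(2 * √(Lf t))) / (Fintype.card E : ℝ) ^ 2 * starEnergy S (u t) := by
      positivity
    simp only [Pi.zero_apply]
    linarith
  obtain ⟨K, hK0, hK⟩ := exists_sum_sq_le_starEnergy hconn
  -- Monotonicity now bounds the oscillation by its initial value, which makes the dissipation rate
  -- uniform for t ≥ 0.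
  set R := √(Lf 0) with hR
  set δ := Real.exp (-(2 * R)) / (Fintype.card E : ℝ) ^ 2 / K with hδ
  have hδ0 : 0 < δ := by positivity
  have hbound : ∀ t, 0 ≤ t → ∀ e, |u t e - k| ≤ R := fun t ht e =>
    (habs t e).trans (Real.sqrt_le_sqrt (hanti ht))
  have hdiss : ∀ t, 0 ≤ t → 2 * ∑ e, u t e * logFlowField S (u t) e ≤ -(2 * δ) * Lf t := by
    intro t ht
    have h1 := sum_mul_logFlowField_le (S := S) (hbound t ht)
    have h2 := hK (u t) k (hsum t)
    have h3 : δ * Lf t ≤ Real.exp (-(2 * R)) / (Fintype.card E : ℝ) ^ 2 * starEnergy S (u t) := by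
      rw [hδ, div_mul_eq_mul_div, div_le_iff₀ hK0, mul_assoc]
      refine mul_le_mul_of_nonneg_left ?_ (by positivity)
      linarith
    linarith
  -- Grönwall with an integrating factor. The square root taken afterwards halves the rate from 2δ
  -- to δ.
  have hM : AntitoneOn (fun t => Lf t * Real.exp (2 * δ * t)) (Ici 0) := by
    have hd : ∀ t, HasDerivAt (fun t => Lf t * Real.exp (2 * δ * t))
        (2 * (∑ e, u t e * logFlowField S (u t) e) * Real.exp (2 * δ * t) +
          Lf t * (Real.exp (2 * δ * t) * (2 * δ))) t := fun t => by
      have h1 : HasDerivAt (fun t => 2 * δ * t) (2 * δ) t := by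
        simpa using (hasDerivAt_id t).const_mul (2 * δ)
      exact (hLd t).mul h1.exp
    refine antitoneOn_of_hasDerivWithinAt_nonpos (convex_Ici 0)
      (fun t _ => (hd t).continuousAt.continuousWithinAt)
      (fun t _ => (hd t).hasDerivWithinAt) fun t ht => ?_
    rw [interior_Ici] at ht
    have := mul_le_mul_of_nonneg_right (hdiss t (le_of_lt ht)) (Real.exp_pos (2 * δ * t)).le
    linarith
  refine ⟨k, R, δ, Real.sqrt_nonneg _, hδ0, fun t ht e => (habs t e).trans ?_⟩
  have h1 := hM self_mem_Ici ht ht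
  simp only [mul_zero, Real.exp_zero, mul_one] at h1
  rw [hR, Real.sqrt_le_left (by positivity), mul_pow, Real.sq_sqrt
    (Finset.sum_nonneg fun _ _ => sq_nonneg _), ← Real.exp_nat_mul]
  rw [← le_div_iff₀ (Real.exp_pos _), div_eq_mul_inv, ← Real.exp_neg] at h1
  refine h1.trans_eq ?_
  congr 2
  push_cast
  ring

end LogFlow

/-! ### The normalized flow on a graph of girth greater than five -/

section GraphFlow

open Classical

variable {V : Type*} [Fintype V] {G : SimpleGraph V}

variable (G) in
/-- The edges at the vertex `x`. -/
noncomputable def edgeStar (x : V) : Finset G.edgeSet := Finset.univ.filter fun e => x ∈ e.1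

theorem mem_edgeStar {x : V} {e : G.edgeSet} : e ∈ edgeStar G x ↔ x ∈ e.1 := by
  simp [edgeStar]

theorem sum_edgeStar (g : G.edgeSet → ℝ) (x : V) :
    ∑ e ∈ edgeStar G x, g e = vertexWeight G g x := by
  unfold vertexWeight
  rw [← Finset.sum_filter_of_ne (p := fun y => G.Adj x y) (s := Finset.univ)]
  · symm
    refine Finset.sum_bij (fun y hy => ⟨s(x, y), (Finset.mem_filter.1 hy).2⟩) (fun y hy => ?_)
      (fun y hy y' hy' h => ?_) (fun e he => ?_) (fun y hy => ?_)
    · rw [mem_edgeStar]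
      exact Sym2.mem_mk_left x y
    · exact Sym2.congr_right.1 (congrArg Subtype.val h)
    · obtain ⟨y, hy⟩ := mem_edgeStar.1 he
      have hadj : G.Adj x y := by
        rw [← SimpleGraph.mem_edgeSet, ← hy]
        exact e.2
      exact ⟨y, by simpa using hadj, Subtype.ext hy.symm⟩
    · exact edgeWeight_of_adj (Finset.mem_filter.1 hy).2
  · intro y _ hne
    by_contra h
    exact hne (edgeWeight_of_not_adj h)

theorem card_edgeStar (x : V) : (edgeStar G x).card = (G.neighborSet x).ncard := by
  have h1 := sum_edgeStar (G := G) (fun _ => 1) x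
  rw [Finset.sum_const, nsmul_eq_mul, mul_one] at h1
  have h2 : vertexWeight G (fun _ => 1) x = ((G.neighborSet x).ncard : ℝ) := by
    have : G.neighborSet x = ((Finset.univ.filter fun y => G.Adj x y : Finset V) : Set V) := by
      ext y; simp
    rw [this, Set.ncard_coe_finset, Finset.card_filter]
    push_cast
    exact Finset.sum_congr rfl fun y _ => by simp [edgeWeight]
  exact_mod_cast h1.trans h2

theorem sum_ite_mem_edgeStar {x y : V} (h : G.Adj x y) (g : V → ℝ) :
    (∑ z, if (⟨s(x, y), h⟩ : G.edgeSet) ∈ edgeStar G z then g z else 0) = g x + g y := by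
  rw [← Finset.sum_filter]
  have : Finset.univ.filter (fun z => (⟨s(x, y), h⟩ : G.edgeSet) ∈ edgeStar G z) = {x, y} := by
    ext z; simp [mem_edgeStar]
  rw [this, Finset.sum_pair h.ne]

theorem sum_sum_ite_mem_edgeStar (g : V → G.edgeSet → ℝ) :
    (∑ e, ∑ z, if e ∈ edgeStar G z then g z e else 0) = ∑ z, ∑ e ∈ edgeStar G z, g z e := by
  rw [Finset.sum_comm]
  refine Finset.sum_congr rfl fun z _ => ?_
  rw [← Finset.sum_filter, Finset.filter_mem_eq_inter, Finset.univ_inter]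

/-- The Lin-Lu-Yau curvature of the edges of a weighted graph of girth greater than five. -/
noncomputable def edgeCurvature (w : G.edgeSet → ℝ) (e : G.edgeSet) : ℝ :=
  2 * (∑ x, if e ∈ edgeStar G x then w e / ∑ f ∈ edgeStar G x, w f else 0) - 2

theorem hasLLYCurvature_edgeCurvature {w : G.edgeSet → ℝ} (hw : ∀ e, 0 < w e)
    (hg : 5 < G.egirth) {x y : V} (h : G.Adj x y) :
    HasLLYCurvature G w x y (edgeCurvature w ⟨s(x, y), h⟩) := by
  have := hasLLYCurvature_of_egirth hw hg h
  rw [edgeWeight_of_adj h] at this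
  rwa [edgeCurvature, sum_ite_mem_edgeStar h, sum_edgeStar, sum_edgeStar]

theorem edgeStar_nonempty (hadj : ∀ x, ∃ y, G.Adj x y) (x : V) : (edgeStar G x).Nonempty := by
  obtain ⟨y, hy⟩ := hadj x
  exact ⟨⟨s(x, y), hy⟩, mem_edgeStar.2 (Sym2.mem_mk_left x y)⟩

theorem edgeAverage_eq (k : G.edgeSet → ℝ) :
    edgeAverage G k = (∑ e, k e) / Fintype.card G.edgeSet := by
  unfold edgeAverage
  congr!

/-- Double counting: every vertex contributes total ratio 1, because it has an edge. -/
theorem edgeAverage_edgeCurvature [Nonempty G.edgeSet] (hadj : ∀ x, ∃ y, G.Adj x y)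
    {w : G.edgeSet → ℝ} (hw : ∀ e, 0 < w e) : edgeAverage G (edgeCurvature w) =
      2 * ((Fintype.card V : ℝ) / Fintype.card G.edgeSet - 1) := by
  have hE : (Fintype.card G.edgeSet : ℝ) ≠ 0 := by exact_mod_cast Fintype.card_ne_zero
  have h1 : ∑ e, edgeCurvature w e = 2 * Fintype.card V - 2 * Fintype.card G.edgeSet := by
    unfold edgeCurvature
    rw [Finset.sum_sub_distrib, ← Finset.mul_sum,
      sum_sum_ite_mem_edgeStar fun z e => w e / ∑ f ∈ edgeStar G z, w f]
    have h2 : ∀ z, ∑ e ∈ edgeStar G z, w e / ∑ f ∈ edgeStar G z, w f = 1 := fun z => by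
      rw [← Finset.sum_div, div_self]
      exact (Finset.sum_pos (fun e _ => hw e) (edgeStar_nonempty hadj z)).ne'
    simp only [h2, Finset.sum_const, Finset.card_univ, nsmul_eq_mul, mul_one]
    ring
  rw [edgeAverage_eq, h1]
  field_simp

/-- In a regular or semi-regular bipartite graph the sum of the inverse degrees of the end points
is the same for all edges. -/
theorem exists_sum_inv_card_eq (hG : IsRegularGraph G ∨ IsSemiregularBipartite G) :
    ∃ b : ℝ, ∀ e : G.edgeSet,
      (∑ x, if e ∈ edgeStar G x then 1 / ((edgeStar G x).card : ℝ) else 0) = b := by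
  rcases hG with ⟨k, hk⟩ | ⟨A, B, a, b, -, hAB, ha, hb⟩
  · refine ⟨1 / k + 1 / k, ?_⟩
    rintro ⟨e, he⟩
    induction e with | _ x y
    rw [sum_ite_mem_edgeStar he, card_edgeStar, card_edgeStar, hk, hk]
  · refine ⟨1 / a + 1 / b, ?_⟩
    rintro ⟨e, he⟩
    induction e with | _ x y
    rw [sum_ite_mem_edgeStar he, card_edgeStar, card_edgeStar]
    rcases hAB.mem_of_adj he with ⟨hx, hy⟩ | ⟨hx, hy⟩
    · rw [ha x hx, hb y hy]
    · rw [hb x hx, ha y hy, add_comm]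

/-- The common value is found by summing over all edges: each vertex contributes deg · 1/deg = 1. -/
theorem sum_inv_card_eq [Nonempty G.edgeSet] (hadj : ∀ x, ∃ y, G.Adj x y)
    (hG : IsRegularGraph G ∨ IsSemiregularBipartite G) (e : G.edgeSet) :
    (∑ x, if e ∈ edgeStar G x then 1 / ((edgeStar G x).card : ℝ) else 0) =
      (Fintype.card V : ℝ) / Fintype.card G.edgeSet := by
  obtain ⟨b, hb⟩ := exists_sum_inv_card_eq hG
  have hE : (Fintype.card G.edgeSet : ℝ) ≠ 0 := by exact_mod_cast Fintype.card_ne_zero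
  have h1 := sum_sum_ite_mem_edgeStar fun (z : V) (_ : G.edgeSet) =>
    1 / ((edgeStar G z).card : ℝ)
  have h2 : ∀ z, ∑ _e ∈ edgeStar G z, 1 / ((edgeStar G z).card : ℝ) = 1 := fun z => by
    have : ((edgeStar G z).card : ℝ) ≠ 0 := by
      exact_mod_cast (edgeStar_nonempty hadj z).card_pos.ne'
    rw [Finset.sum_const, nsmul_eq_mul, mul_one_div_cancel this]
  simp only [hb, h2, Finset.sum_const, Finset.card_univ, nsmul_eq_mul, mul_one] at h1
  rw [hb, ← h1, mul_div_cancel_left₀ _ hE]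

/-- This is where regularity or semi-regularity enters: the constant |V|/|E| can be written as the
sum of the inverse degrees at the ends of any edge. -/
theorem neg_edgeCurvature_sub_average [Nonempty G.edgeSet] (hadj : ∀ x, ∃ y, G.Adj x y)
    (hG : IsRegularGraph G ∨ IsSemiregularBipartite G) (u : G.edgeSet → ℝ) (e : G.edgeSet) :
    -(edgeCurvature (fun f => Real.exp (u f)) e -
      edgeAverage G (edgeCurvature fun f => Real.exp (u f))) = logFlowField (edgeStar G) u e := by
  rw [edgeAverage_edgeCurvature hadj fun f => Real.exp_pos _, ← sum_inv_card_eq hadj hG e,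
    edgeCurvature, logFlowField]
  have : ∀ a b : ℝ, -(2 * a - 2 - 2 * (b - 1)) = 2 * (b - a) := fun a b => by ring
  rw [this, ← Finset.sum_sub_distrib]
  congr 1
  refine Finset.sum_congr rfl fun x _ => ?_
  split_ifs <;> simp

/-- A walk in the graph is a chain of edges in which successive ones share a vertex. -/
theorem reflTransGen_edgeStar (hG : ∀ x y, G.Reachable x y) (e f : G.edgeSet) :
    Relation.ReflTransGen (fun e f => ∃ x, e ∈ edgeStar G x ∧ f ∈ edgeStar G x) e f := by
  have key : ∀ {x y : V} (_ : G.Walk x y) (e f : G.edgeSet), e ∈ edgeStar G x →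
      f ∈ edgeStar G y →
      Relation.ReflTransGen (fun e f => ∃ x, e ∈ edgeStar G x ∧ f ∈ edgeStar G x) e f := by
    intro x y p
    induction p with
    | nil => exact fun e f he hf => .single ⟨_, he, hf⟩
    | @cons x x' y h p ih =>
      intro e f he hf
      exact (Relation.ReflTransGen.single ⟨x, he, mem_edgeStar.2 (Sym2.mem_mk_left x x')⟩).trans
        (ih ⟨s(x, x'), h⟩ f (mem_edgeStar.2 (Sym2.mem_mk_right x x')) hf)
  obtain ⟨p⟩ := hG (Quot.out e.1).1 (Quot.out f.1).1
  exact key p e f (mem_edgeStar.2 (Sym2.out_fst_mem _)) (mem_edgeStar.2 (Sym2.out_fst_mem _))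

variable {w₀ : G.edgeSet → ℝ}

theorem isNormalizedFlow_exp [Nonempty G.edgeSet] (hg : 5 < G.egirth)
    (hadj : ∀ x, ∃ y, G.Adj x y) (hG : IsRegularGraph G ∨ IsSemiregularBipartite G)
    {u : ℝ → G.edgeSet → ℝ} (h0 : ∀ e, Real.exp (u 0 e) = w₀ e)
    (hu : ∀ t, HasDerivAt u (logFlowField (edgeStar G) (u t)) t) :
    IsNormalizedFlow G w₀ (fun t e => Real.exp (u t e))
      (fun t => edgeCurvature fun e => Real.exp (u t e)) where
  initial := funext h0
  pos _ _ _ := Real.exp_pos _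
  continuousOn e := fun t _ =>
    (hasDerivAt_pi.1 (hu t) e).exp.continuousAt.continuousWithinAt
  curvature t _ x y h := hasLLYCurvature_edgeCurvature (fun _ => Real.exp_pos _) hg h
  flow t _ e := by
    have := (hasDerivAt_pi.1 (hu t) e).exp
    rwa [← neg_edgeCurvature_sub_average hadj hG, mul_comm] at this

/-- Limits are unique, so the weights determine `κ` at positive times. Uniqueness of the flow thus
reduces to an autonomous equation for the weights. -/
theorem IsNormalizedFlow.curvature_eq (hg : 5 < G.egirth) {w κ : ℝ → G.edgeSet → ℝ}
    (h : IsNormalizedFlow G w₀ w κ) {t : ℝ} (ht : 0 < t) : κ t = edgeCurvature (w t) := by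
  funext ⟨e, he⟩
  induction e with | _ x y
  exact tendsto_nhds_unique (h.curvature t ht x y he)
    (hasLLYCurvature_edgeCurvature (h.pos t ht.le) hg he)

theorem IsNormalizedFlow.hasDerivAt_log [Nonempty G.edgeSet] (hg : 5 < G.egirth)
    (hadj : ∀ x, ∃ y, G.Adj x y) (hG : IsRegularGraph G ∨ IsSemiregularBipartite G)
    {w κ : ℝ → G.edgeSet → ℝ} (h : IsNormalizedFlow G w₀ w κ) {t : ℝ} (ht : 0 < t) :
    HasDerivAt (fun s e => Real.log (w s e))
      (logFlowField (edgeStar G) fun e => Real.log (w t e)) t := by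
  refine hasDerivAt_pi.2 fun e => ?_
  have hpos := h.pos t ht.le
  have h1 := (h.flow t ht e).log (hpos e).ne'
  rw [mul_div_cancel_right₀ _ (hpos e).ne', h.curvature_eq hg ht] at h1
  have h2 : (fun f => Real.exp (Real.log (w t f))) = w t := funext fun f => Real.exp_log (hpos f)
  have h3 := neg_edgeCurvature_sub_average hadj hG (fun e => Real.log (w t e)) e
  rw [h2] at h3
  rwa [h3] at h1

theorem IsNormalizedFlow.unique [Nonempty G.edgeSet] (hg : 5 < G.egirth)
    (hadj : ∀ x, ∃ y, G.Adj x y) (hG : IsRegularGraph G ∨ IsSemiregularBipartite G)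
    {w κ w' κ' : ℝ → G.edgeSet → ℝ} (h : IsNormalizedFlow G w₀ w κ)
    (h' : IsNormalizedFlow G w₀ w' κ') {t : ℝ} (ht : 0 ≤ t) : w' t = w t := by
  have hcont : ∀ {w κ : ℝ → G.edgeSet → ℝ}, IsNormalizedFlow G w₀ w κ →
      ContinuousOn (fun s e => Real.log (w s e)) (Ici 0) := fun h =>
    continuousOn_pi.2 fun e => (h.continuousOn e).log fun s hs => (h.pos s hs e).ne'
  have := integralCurve_unique contDiff_logFlowField (hcont h')
    (fun s hs => h'.hasDerivAt_log hg hadj hG hs) (hcont h)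
    (fun s hs => h.hasDerivAt_log hg hadj hG hs) (by rw [h.initial, h'.initial]) ht
  funext e
  exact Real.log_injOn_pos (h'.pos t ht e) (h.pos t ht e) (congrFun this e)

/-- Transfers the decay from logarithmic coordinates to the weights: both arguments are at most `k +
C`, where the slope of exp is at most exp (k + C). -/
theorem abs_exp_sub_exp_le {a k C : ℝ} (h : |a - k| ≤ C) :
    |Real.exp a - Real.exp k| ≤ Real.exp (k + C) * |a - k| := by
  have key : ∀ {a b : ℝ}, b ≤ a → a ≤ k + C →
      |Real.exp a - Real.exp b| ≤ Real.exp (k + C) * |a - b| := by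
    intro a b hab ha
    rw [abs_of_nonneg (sub_nonneg.2 (Real.exp_le_exp.2 hab)), abs_of_nonneg (sub_nonneg.2 hab)]
    have h1 : Real.exp b = Real.exp a * Real.exp (b - a) := by rw [← Real.exp_add]; ring_nf
    have h2 := mul_le_mul_of_nonneg_left (Real.add_one_le_exp (b - a)) (Real.exp_pos a).le
    have h3 := mul_le_mul_of_nonneg_right (Real.exp_le_exp.2 ha) (sub_nonneg.2 hab)
    linarith
  have h1 := abs_le.1 h
  rcases le_total k a with hk | hk
  · exact key hk (by linarith)
  · rw [abs_sub_comm, abs_sub_comm a]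
    exact key hk (by linarith)

/-- On a connected regular or semi-regular bipartite graph of girth greater than five the
normalized flow has a unique positive solution, and it converges exponentially fast to constant
weights. -/
theorem exists_normalizedFlow [Nonempty G.edgeSet] (hg : 5 < G.egirth)
    (hadj : ∀ x, ∃ y, G.Adj x y) (hconn : ∀ x y, G.Reachable x y)
    (hG : IsRegularGraph G ∨ IsSemiregularBipartite G) (hw₀ : ∀ e, 0 < w₀ e) :
    ∃ w κ : ℝ → G.edgeSet → ℝ, IsNormalizedFlow G w₀ w κ ∧
      (∀ w' κ' : ℝ → G.edgeSet → ℝ, IsNormalizedFlow G w₀ w' κ' → ∀ t, 0 ≤ t → w' t = w t) ∧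
      (∀ t, 0 < t → edgeAverage G (κ t) =
        2 * ((Nat.card V : ℝ) / (Nat.card G.edgeSet : ℝ) - 1)) ∧
      ∃ c : ℝ, 0 < c ∧ Tendsto w atTop (𝓝 fun _ => c) ∧
        ∃ C lam : ℝ, 0 < lam ∧ ∀ t, 0 ≤ t → ∀ e, |w t e - c| ≤ C * Real.exp (-lam * t) := by
  obtain ⟨u, hu0, hu⟩ := exists_integralCurve (contDiff_logFlowField (S := edgeStar G))
    norm_logFlowField_le (fun e => Real.log (w₀ e))
  have hflow := isNormalizedFlow_exp (w₀ := w₀) hg hadj hG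
    (fun e => by rw [hu0, Real.exp_log (hw₀ e)]) hu
  refine ⟨_, _, hflow, fun w' κ' h' t ht => hflow.unique hg hadj hG h' ht, fun t _ => ?_, ?_⟩
  · rw [Nat.card_eq_fintype_card, Nat.card_eq_fintype_card]
    exact edgeAverage_edgeCurvature hadj fun _ => Real.exp_pos _
  obtain ⟨k, C, lam, hC, hlam, hle⟩ :=
    exists_abs_sub_le_exp_of_logFlow (reflTransGen_edgeStar hconn) hu
  have hexp : ∀ t, 0 ≤ t → ∀ e, |Real.exp (u t e) - Real.exp k| ≤
      Real.exp (k + C) * C * Real.exp (-lam * t) := by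
    intro t ht e
    have h1 : Real.exp (-lam * t) ≤ 1 := Real.exp_le_one_iff.2 (by nlinarith)
    have h2 : |u t e - k| ≤ C := (hle t ht e).trans (mul_le_of_le_one_right hC h1)
    refine (abs_exp_sub_exp_le h2).trans ?_
    rw [mul_assoc]
    exact mul_le_mul_of_nonneg_left (hle t ht e) (Real.exp_pos _).le
  refine ⟨Real.exp k, Real.exp_pos k, tendsto_pi_nhds.2 fun e => ?_, _, lam, hlam, hexp⟩
  rw [tendsto_iff_dist_tendsto_zero]
  have hlim : Tendsto (fun t => Real.exp (k + C) * C * Real.exp (-lam * t)) atTop (𝓝 0) := by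
    have h1 : Tendsto (fun t => -lam * t) atTop atBot :=
      tendsto_id.const_mul_atTop_of_neg (neg_neg_of_pos hlam)
    simpa using (Real.tendsto_exp_atBot.comp h1).const_mul (Real.exp (k + C) * C)
  refine squeeze_zero' (.of_forall fun t => dist_nonneg) ?_ hlim
  filter_upwards [eventually_ge_atTop 0] with t ht
  exact hexp t ht e

end GraphFlow

/-! ### The flow on a tiled surface -/

theorem PolygonalTiling.edgeDist_pos {V F X : Type*} [TopologicalSpace X]
    (T : PolygonalTiling V F X) (m : MetricSpace X) (e : T.graph.edgeSet) :
    0 < T.edgeDist m e := by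
  obtain ⟨e, he⟩ := e
  induction e with | _ x y
  exact (@dist_pos X m _ _).2 fun h => SimpleGraph.Adj.ne he (T.vertex_injective h)

theorem IsGeodesicMetric.t2Space {X : Type*} {m : MetricSpace X} [t : TopologicalSpace X]
    (h : IsGeodesicMetric m) : T2Space X := by
  have ht2 : ∀ {Y : Type _} [MetricSpace Y], T2Space Y := inferInstance
  exact h.1 ▸ @ht2 X m

theorem mainTheorem9 {V F X : Type*} [Fintype V] [Fintype F]
    [TopologicalSpace X] [ChartedSpace (EuclideanSpace ℝ (Fin 2)) X]
    [CompactSpace X] [ConnectedSpace X]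
    (m : MetricSpace X) (hm : IsGeodesicMetric m)
    (T : PolygonalTiling V F X)
    (hT : IsRegularGraph T.graph ∨ IsSemiregularBipartite T.graph)
    (hgirth : 5 < T.graph.egirth) :
    ∃ w κ : ℝ → T.graph.edgeSet → ℝ,
      IsNormalizedFlow T.graph (T.edgeDist m) w κ ∧
      (∀ w' κ' : ℝ → T.graph.edgeSet → ℝ, IsNormalizedFlow T.graph (T.edgeDist m) w' κ' →
        ∀ t, 0 ≤ t → w' t = w t) ∧
      (∀ t, 0 < t → edgeAverage T.graph (κ t) =
        2 * ((Nat.card V : ℝ) / (Nat.card T.graph.edgeSet : ℝ) - 1)) ∧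
      ∃ c : ℝ, 0 < c ∧
        Tendsto w atTop (𝓝 fun _ => c) ∧
        (∃ C lam : ℝ, 0 < lam ∧ ∀ t, 0 ≤ t → ∀ e, |w t e - c| ≤ C * Real.exp (-lam * t)) ∧
        ∃ m' : MetricSpace X, IsGeodesicMetric m' ∧ T.HasConstantEdgeLength m' c := by
  have := hm.t2Space
  have hne : Nonempty T.graph.edgeSet := by
    obtain ⟨f, -⟩ := T.cover (Classical.arbitrary X)
    exact ⟨⟨s(_, _), T.corner_adj f 0⟩⟩
  obtain ⟨w, κ, hflow, huniq, havg, c, hc, hlim, hexp⟩ := exists_normalizedFlow hgirth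
    T.exists_adj T.reachable hT (T.edgeDist_pos m)
  exact ⟨w, κ, hflow, huniq, havg, c, hc, hlim, hexp,
    T.exists_isGeodesicMetric_hasConstantEdgeLength hc⟩
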